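/- Let $\alpha>2$ and $\lambda,\theta,\gamma,\delta>0$. Consider a network on the plane consisting of a typical node $X_0$ at the origin and of further nodes $X_1,X_2,\dots$ that form a homogeneous Poisson point process of intensity $\lambda$. Every unordered pair of nodes $X_i,X_j$ has a fading gain $G_{ij}=G_{ji}$; these gains are independent, exponentially distributed with mean $1$, and independent of the locations. The channel gain between $X_i$ and $X_j$ is $G_{ij}|X_i-X_j|^{-\alpha}$, and the neighbors of $X_i$ are the nodes $X_j$ in $\mathcal N(X_i)=\{X_j: j\ne i,\ G_{ij}|X_i-X_j|^{-\alpha}\ge\theta\}$. Time is divided into frames of $S$ symbols each, where $S$ is an integer with $S\ge L/\log_2(1+\delta)$ and $L\ge 1$ is the number of bits in a frame. In each frame, every node $X_i$ draws a timer $T_i$ uniformly from $[0,1]$, all timers being independent over nodes and frames and independent of the locations and fading gains, which stay fixed; $X_i$ transmits in the frame if and only if $T_j>T_i$ for all $X_j\in\mathcal N(X_i)$ (Matérn hard-core model of CSMA). The message of a neighbor $X=X_i$ of $X_0$ is received by $X_0$ in a frame if and only if $X_i$ transmits in that frame and $$\frac{\gamma\, G_{0i}|X_i|^{-\alpha}}{\gamma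 I+1}\ge\delta ,$$ where $I$ is the sum of $G_{0j}|X_j|^{-\alpha}$ over all nodes $X_j$, $j\notin\{0,i\}$, that transmit in that frame. Then the mean number of neighbors of $X_0$ is $c=\frac{2}{\alpha}\pi\lambda\theta^{-2/\alpha}\Gamma(2/\alpha)$. Let $M_c\ge 0$ be an integer, and let $\mathsf P_e$ be the probability that $X_0$ receives the message of a given neighbor in none of the $\lfloor M_c/S\rfloor$ complete frames contained in $M_c$ symbol transmissions; that is, $\mathsf P_e$ is the expected number of neighbors of $X_0$ whose message is received in none of these frames, divided by the expected number of neighbors of $X_0$ (Palm probability). Then $$\mathsf P_e\ \ge\ \left(\max\left\{0,\ 1-\frac1{c^2}\left(\frac{\theta\gamma}{\delta}\right)^{2/\alpha}\left(e^{-c}+c-1\right)\right\}\right)^{n_c},\qquad n_c=\frac{M_c\log_2(1+\delta)}{L}.$$ -/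

import Mathlib

open MeasureTheory ProbabilityTheory
open scoped ENNReal

noncomputable section

/-- The Euclidean plane. -/
abbrev Plane : Type := EuclideanSpace ℝ (Fin 2)

/-- The number (possibly infinite) of points of the enumerated point process `pt` that lie
in `B`. -/
def pointCount {Ω E : Type*} (pt : ℕ → Ω → E) (B : Set E) (ω : Ω) : ℕ∞ :=
  {i : ℕ | pt i ω ∈ B}.encard

/-- `pt` is a measurable enumeration of the points of a Poisson point process with intensity
measure `ν`: the number of points in a measurable set `B` with `ν B < ∞` is Poisson
distributed with mean `ν B`, and the numbers of points in disjoint measurable sets are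
independent. (An enumeration by `ℕ` is available when `ν` is infinite, since there are then
almost surely infinitely many points.) -/
structure IsPoissonProcess {Ω E : Type*} [MeasurableSpace Ω] [MeasurableSpace E]
    (pt : ℕ → Ω → E) (ν : Measure E) (μ : Measure Ω) : Prop where
  measurable : ∀ i, Measurable (pt i)
  count_law : ∀ B : Set E, MeasurableSet B → ν B < ∞ → ∀ k : ℕ,
    μ {ω | pointCount pt B ω = (k : ℕ∞)} = poissonMeasure (ν B).toNNReal {k}
  count_indep : ∀ (n : ℕ) (B : Fin n → Set E), (∀ m, MeasurableSet (B m)) →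
    Pairwise (Function.onFun Disjoint B) → iIndepFun (fun m ω => pointCount pt (B m) ω) μ

/-- The nodes of the network: `none` is the typical node `X₀`, and `some i` is the `i`-th of
the other nodes. -/
abbrev Node : Type := Option ℕ

/-- The random network with the typical node at the origin.

* `pt` enumerates the nodes other than the typical one: a homogeneous Poisson point process of
  intensity `lam` on the plane.
* `fading s(i, j)` is the (reciprocal) small-scale fading power gain of the link between the
  nodes `i` and `j`: independent exponential variables with mean one (Rayleigh fading). The
  entries on the diagonal of `Sym2 Node` are never used.
* `timer k i` is the timer offset of node `i` in frame `k`: independent, uniform on `[0, 1]`.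

The locations, the fading gains and the timers are mutually independent. -/
structure Network {Ω : Type*} [MeasurableSpace Ω] (μ : Measure Ω) (lam : ℝ) where
  pt : ℕ → Ω → Plane
  fading : Sym2 Node → Ω → ℝ
  timer : ℕ → Node → Ω → ℝ
  poisson : IsPoissonProcess pt (ENNReal.ofReal lam • (volume : Measure Plane)) μ
  fading_measurable : ∀ e, Measurable (fading e)
  fading_law : ∀ e, μ.map (fading e) = expMeasure 1
  fading_indep : iIndepFun fading μ
  timer_measurable : ∀ k i, Measurable (timer k i)
  timer_law : ∀ k i, μ.map (timer k i) = (volume : Measure ℝ).restrict (Set.Icc 0 1)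
  timer_indep : iIndepFun (fun p : ℕ × Node => timer p.1 p.2) μ
  fading_timer_indep : IndepFun (fun ω e => fading e ω)
    (fun ω (p : ℕ × Node) => timer p.1 p.2 ω) μ
  pt_mark_indep : IndepFun (fun ω i => pt i ω)
    (fun ω => ((fun e => fading e ω), (fun p : ℕ × Node => timer p.1 p.2 ω))) μ

namespace Network

variable {Ω : Type*} [MeasurableSpace Ω] {μ : Measure Ω} {lam : ℝ}

/-- The location of a node; the typical node is at the origin. -/
def loc (N : Network μ lam) (ω : Ω) : Node → Plane
  | none => 0
  | some i => N.pt i ω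

/-- The channel gain `G_{ij} R_{ij}^{-α}` between two nodes. -/
def gain (N : Network μ lam) (α : ℝ) (ω : Ω) (i j : Node) : ℝ :=
  N.fading s(i, j) ω * dist (N.loc ω i) (N.loc ω j) ^ (-α)

/-- Node `j` is a neighbor of node `i`: the channel gain between them is at least `θ`. -/
def IsNeighbor (N : Network μ lam) (α θ : ℝ) (ω : Ω) (i j : Node) : Prop :=
  j ≠ i ∧ θ ≤ N.gain α ω i j

/-- Node `i` transmits in frame `k`: its timer expires before the timers of all of its
neighbors. -/
def Transmits (N : Network μ lam) (α θ : ℝ) (k : ℕ) (ω : Ω) (i : Node) : Prop :=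
  ∀ j : Node, N.IsNeighbor α θ ω i j → N.timer k i ω < N.timer k j ω

open Classical in
/-- The interference at the typical node in frame `k`, when it listens to node `some i`: the
total channel gain from all other nodes that transmit in that frame. -/
def interference (N : Network μ lam) (α θ : ℝ) (k : ℕ) (ω : Ω) (i : ℕ) : ℝ≥0∞ :=
  ∑' j : ℕ, if j ≠ i ∧ N.Transmits α θ k ω (some j) then
    ENNReal.ofReal (N.gain α ω none (some j)) else 0

/-- The signal-to-interference-plus-noise ratio at the typical node for the signal of node
`some i` in frame `k`; the noise has unit variance and `γ` is the nominal SNR. -/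
def sinr (N : Network μ lam) (α θ γ : ℝ) (k : ℕ) (ω : Ω) (i : ℕ) : ℝ≥0∞ :=
  ENNReal.ofReal (γ * N.gain α ω none (some i)) /
    (ENNReal.ofReal γ * N.interference α θ k ω i + 1)

/-- The typical node receives the message of node `some i` in frame `k`: the latter transmits
and its SINR is at least `δ`. -/
def Received (N : Network μ lam) (α θ γ δ : ℝ) (k : ℕ) (ω : Ω) (i : ℕ) : Prop :=
  N.Transmits α θ k ω (some i) ∧ ENNReal.ofReal δ ≤ N.sinr α θ γ k ω i

/-- The mean number of neighbors of the typical node. -/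
def meanNeighbors (N : Network μ lam) (α θ : ℝ) : ℝ≥0∞ :=
  ∫⁻ ω, (({i : ℕ | N.IsNeighbor α θ ω none (some i)}.encard : ℕ∞) : ℝ≥0∞) ∂μ

/-- The mean number of neighbors of the typical node whose message it receives in none of the
first `Mf` frames. -/
def meanMissed (N : Network μ lam) (α θ γ δ : ℝ) (Mf : ℕ) : ℝ≥0∞ :=
  ∫⁻ ω, (({i : ℕ | N.IsNeighbor α θ ω none (some i) ∧
    ∀ k < Mf, ¬ N.Received α θ γ δ k ω i}.encard : ℕ∞) : ℝ≥0∞) ∂μ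

/-- The probability that the typical node fails to receive the message of a given neighbor in
`Mf` consecutive frames. Conditioning on a given point of the process being a neighbor is
meant in the sense of Palm: this is the mass that the normalized Campbell measure
`A ↦ 𝔼 (∑_{X ∈ 𝒩(X₀)} 1_A(X)) / 𝔼 |𝒩(X₀)|` gives to the failure event. -/
def errorProb (N : Network μ lam) (α θ γ δ : ℝ) (Mf : ℕ) : ℝ≥0∞ :=
  N.meanMissed α θ γ δ Mf / N.meanNeighbors α θ

end Network

/-- The number `c = (2/α) π λ θ^{-2/α} Γ(2/α)`. -/
def neighborConst (lam α θ : ℝ) : ℝ :=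
  2 / α * Real.pi * lam * θ ^ (-2 / α) * Real.Gamma (2 / α)

end

/-!
Receiving the message of a neighbor requires that the neighbor transmits and that its gain to the
typical node is at least `δ / γ`, because interference only lowers the SINR. The proof bounds the
probability of this larger event in one frame, and then passes to many frames by convexity.

*One frame.* Fix the locations, and let `s` be the timer of a node at `x`. Each other node at `y`
spoils the transmission, independently of the rest, when it is a neighbor of `x` and its timer is
at most `s`, which has probability `s exp (-θ ‖x - y‖ ^ α)`; the typical node must have a timer
above `s`. Averaging the resulting product over the Poisson process (the points other than `x`
form the same Poisson process) gives at most `(1 - s) exp (-s c)`, and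
`∫₀¹ (1 - s) exp (-s c) ds = (exp (-c) + c - 1) / c ^ 2`. The mean number of nodes with gain at
least `t` is `c (θ / t) ^ (2 / α)`, so that the mean number of strong transmitters, divided by `c`,
is at most the number subtracted from `1` in the statement
(`Network.tsum_measure_strongTransmission_le`, `Network.tsum_measure_isNeighbor_inter_le`).

*The Poisson average.* Only an inequality of Mecke type is needed
(`tsum_lintegral_mul_isolationProb_le`). The plane is cut into cells of radius `ε`. For a point in
a cell `C`, the product over the points outside `C` is bounded by one that depends on `C` only,
hence is independent of the number of points in `C`; the latter has mean `ν C`. The Laplace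
functional bound (`IsPoissonProcess.lintegral_pointCount_mul_iInf_prod_le`) is read off from the
generating functions of finitely many independent counts, by approximation from below with simple
functions. Finally `ε → 0`.

*Many frames.* Given locations and fading gains, the frames are independent and identically
distributed, so `n` frames fail with conditional probability `(1 - q) ^ n`, where `q` is the
conditional probability of success. Jensen's inequality for the Palm average of this convex
function of `q` (`tsum_mul_one_sub_pow_le`) gives the bound with exponent `n = ⌊Mc / S⌋ ≤ n_c`, and
raising a base in `[0, 1]` to the larger exponent `n_c` only decreases it.
-/

/-! ### Counting functionals of a Poisson process -/

section PoissonProcess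

variable {Ω E : Type*} [MeasurableSpace Ω] [MeasurableSpace E] {μ : Measure Ω}
  {pt : ℕ → Ω → E} {ν : Measure E}

theorem measurable_pointCount (hpt : ∀ i, Measurable (pt i)) {B : Set E} (hB : MeasurableSet B) :
    Measurable (pointCount pt B) := by
  refine measurable_encard.comp (measurable_set_iff.2 fun i => ?_)
  exact (measurable_mem.2 hB).comp (hpt i)

theorem coe_encard_eq_tsum (S : Set ℕ) :
    ((S.encard : ℕ∞) : ℝ≥0∞) = ∑' i, S.indicator (1 : ℕ → ℝ≥0∞) i := by
  rw [← Measure.count_apply (MeasurableSet.of_discrete), ← lintegral_indicator_one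
    (MeasurableSet.of_discrete), lintegral_count]

theorem lintegral_encard_setOf {Ω : Type*} [MeasurableSpace Ω] {μ : Measure Ω}
    {P : ℕ → Ω → Prop} (hP : ∀ i, MeasurableSet {ω | P i ω}) :
    ∫⁻ ω, (({i | P i ω}.encard : ℕ∞) : ℝ≥0∞) ∂μ = ∑' i, μ {ω | P i ω} := by
  simp_rw [coe_encard_eq_tsum]
  rw [lintegral_tsum (f := fun i ω => {i | P i ω}.indicator (1 : ℕ → ℝ≥0∞) i)
    fun i => (measurable_one.indicator (hP i)).aemeasurable]
  exact tsum_congr fun i => lintegral_indicator_one (hP i)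

theorem pointCount_eq_tsum {Ω E : Type*} {pt : ℕ → Ω → E} (B : Set E) (ω : Ω) :
    ((pointCount pt B ω : ℕ∞) : ℝ≥0∞) = ∑' i, B.indicator 1 (pt i ω) :=
  coe_encard_eq_tsum _

namespace IsPoissonProcess

/-- The law of a count is the Poisson law, carried from `ℕ` to `ℕ∞`. -/
theorem map_pointCount [IsProbabilityMeasure μ] (h : IsPoissonProcess pt ν μ) {B : Set E}
    (hB : MeasurableSet B) (hν : ν B < ∞) :
    μ.map (pointCount pt B) = (poissonMeasure (ν B).toNNReal).map (Nat.cast : ℕ → ℕ∞) := by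
  have hm := measurable_pointCount h.measurable hB
  have : IsProbabilityMeasure (μ.map (pointCount pt B)) :=
    Measure.isProbabilityMeasure_map hm.aemeasurable
  have : IsProbabilityMeasure ((poissonMeasure (ν B).toNNReal).map (Nat.cast : ℕ → ℕ∞)) :=
    Measure.isProbabilityMeasure_map (by fun_prop)
  symm
  refine Measure.eq_of_le_of_measure_univ_eq ?_ (by simp)
  refine Measure.le_intro fun s hs _ => ?_
  rw [Measure.map_apply (by fun_prop) hs, Measure.map_apply hm hs,
    ← Set.biUnion_of_singleton ((Nat.cast : ℕ → ℕ∞) ⁻¹' s),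
    measure_biUnion (Set.to_countable _) (fun a _ b _ hab => by simpa using hab)
      (fun _ _ => MeasurableSet.of_discrete)]
  have : ∀ k : ℕ, poissonMeasure (ν B).toNNReal {k} = μ (pointCount pt B ⁻¹' {(k : ℕ∞)}) :=
    fun k => (h.count_law B hB hν k).symm
  simp_rw [this]
  rw [← measure_biUnion (Set.to_countable _) (fun a _ b _ hab => ?_)
      (fun _ _ => hm (measurableSet_singleton _))]
  · refine measure_mono ?_
    intro ω hω
    simp only [Set.mem_iUnion] at hω
    obtain ⟨k, hk, hω⟩ := hω
    simp only [Set.mem_preimage, Set.mem_singleton_iff] at hω hk ⊢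
    rwa [hω]
  · refine Set.disjoint_left.2 fun ω h1 h2 => hab ?_
    simp only [Set.mem_preimage, Set.mem_singleton_iff] at h1 h2
    exact_mod_cast h1.symm.trans h2

theorem lintegral_comp_pointCount [IsProbabilityMeasure μ] (h : IsPoissonProcess pt ν μ)
    {B : Set E} (hB : MeasurableSet B) (hν : ν B < ∞) (g : ℕ∞ → ℝ≥0∞) :
    ∫⁻ ω, g (pointCount pt B ω) ∂μ = ∑' k : ℕ, g k *
      ENNReal.ofReal (Real.exp (-(ν B).toReal) * (ν B).toReal ^ k / k.factorial) := by
  rw [← lintegral_map (f := g) (by fun_prop) (measurable_pointCount h.measurable hB),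
    h.map_pointCount hB hν, lintegral_map (by fun_prop) (by fun_prop), lintegral_countable']
  simp [poissonMeasure_singleton, ENNReal.toReal]

theorem lintegral_pointCount [IsProbabilityMeasure μ] (h : IsPoissonProcess pt ν μ)
    {B : Set E} (hB : MeasurableSet B) (hν : ν B < ∞) :
    ∫⁻ ω, ((pointCount pt B ω : ℕ∞) : ℝ≥0∞) ∂μ = ν B := by
  rw [h.lintegral_comp_pointCount hB hν (fun k => (k : ℝ≥0∞))]
  set r := (ν B).toReal with hr
  have hr0 : 0 ≤ r := ENNReal.toReal_nonneg
  have hs : HasSum (fun k : ℕ => r * (Real.exp (-r) * r ^ k / k.factorial)) (r * 1) := by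
    exact (hasSum_one_poissonMeasure (ν B).toNNReal).mul_left r
  have hs' : HasSum (fun k : ℕ => (k : ℝ) * (Real.exp (-r) * r ^ k / k.factorial)) r := by
    rw [← hasSum_nat_add_iff' 1]
    simp only [Finset.range_one, Finset.sum_singleton, Nat.cast_zero, zero_mul, sub_zero]
    rw [mul_one] at hs
    refine hs.congr_fun fun k => ?_
    have : (k.factorial : ℝ) ≠ 0 := by positivity
    rw [Nat.factorial_succ]
    push_cast
    field_simp
    ring
  rw [← ENNReal.ofReal_toReal hν.ne, ← hr]
  conv_rhs => rw [← hs'.tsum_eq]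
  rw [
    ENNReal.ofReal_tsum_of_nonneg (fun k => by positivity) hs'.summable]
  refine tsum_congr fun k => ?_
  rw [ENNReal.ofReal_mul (by positivity)]
  simp

/-- The probability generating function of a count. On the null event of an infinite count,
`toNat` gives the exponent `0`. -/
theorem lintegral_pow_pointCount [IsProbabilityMeasure μ] (h : IsPoissonProcess pt ν μ)
    {B : Set E} (hB : MeasurableSet B) (hν : ν B < ∞) {a : ℝ} (ha : a ≤ 1) :
    ∫⁻ ω, ENNReal.ofReal (1 - a) ^ (pointCount pt B ω).toNat ∂μ =
      ENNReal.ofReal (Real.exp (-(a * (ν B).toReal))) := by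
  rw [h.lintegral_comp_pointCount hB hν (fun k => ENNReal.ofReal (1 - a) ^ k.toNat)]
  set r := (ν B).toReal with hr
  have hr0 : 0 ≤ r := ENNReal.toReal_nonneg
  have hs : HasSum (fun k : ℕ => (1 - a) ^ k * (Real.exp (-r) * r ^ k / k.factorial))
      (Real.exp (-(a * r))) := by
    have h1 := (NormedSpace.expSeries_div_hasSum_exp ((1 - a) * r)).mul_left (Real.exp (-r))
    rw [← Real.exp_eq_exp_ℝ, ← Real.exp_add] at h1
    convert! h1 using 1
    · ext k
      rw [mul_pow]; ring
    · congr 1; ring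
  rw [← hs.tsum_eq, ENNReal.ofReal_tsum_of_nonneg
    (fun k => by have : 0 ≤ 1 - a := by linarith
                 positivity) hs.summable]
  refine tsum_congr fun k => ?_
  rw [ENNReal.ofReal_mul (by have : 0 ≤ 1 - a := by linarith
                             positivity), ENNReal.ofReal_pow (by linarith)]
  simp

theorem iIndepFun_pointCount (h : IsPoissonProcess pt ν μ) {ι : Type*} [Fintype ι] {B : ι → Set E}
    (hB : ∀ i, MeasurableSet (B i)) (hd : Pairwise (Function.onFun Disjoint B)) :
    iIndepFun (fun i ω => pointCount pt (B i) ω) μ := by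
  have h1 := h.count_indep (Fintype.card ι) (fun m => B ((Fintype.equivFin ι).symm m))
    (fun m => hB _) (fun a b hab => hd (by simpa using hab))
  simpa using h1.precomp (Fintype.equivFin ι).injective

/-- Campbell's formula: the intensity measure of the process is `ν`. -/
theorem sum_map_eq [IsProbabilityMeasure μ] [SigmaFinite ν] (h : IsPoissonProcess pt ν μ) :
    Measure.sum (fun i => μ.map (pt i)) = ν := by
  have key : ∀ B, MeasurableSet B → ν B < ∞ → Measure.sum (fun i => μ.map (pt i)) B = ν B := by
    intro B hB hν
    rw [Measure.sum_apply _ hB, ← h.lintegral_pointCount hB hν]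
    simp_rw [pointCount_eq_tsum]
    rw [lintegral_tsum (f := fun i ω => B.indicator 1 (pt i ω)) (fun i =>
      ((measurable_one.indicator hB).comp (h.measurable i)).aemeasurable)]
    refine tsum_congr fun i => ?_
    rw [← lintegral_map (f := B.indicator 1) (measurable_one.indicator hB) (h.measurable i),
      lintegral_indicator_one hB]
  refine Measure.ext fun B hB => ?_
  have hU : B = ⋃ n, B ∩ spanningSets ν n := by
    rw [← Set.inter_iUnion, iUnion_spanningSets, Set.inter_univ]
  have hmono : Monotone fun n => B ∩ spanningSets ν n :=
    fun a b hab => Set.inter_subset_inter_right _ (monotone_spanningSets ν hab)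
  rw [hU, hmono.measure_iUnion, hmono.measure_iUnion]
  exact iSup_congr fun n => key _ (hB.inter (measurableSet_spanningSets ν n))
    ((measure_mono Set.inter_subset_right).trans_lt (measure_spanningSets_lt_top ν n))

end IsPoissonProcess

end PoissonProcess

/-! ### A Laplace-functional bound for a Poisson process -/

section LaplaceBound

variable {Ω E : Type*} [MeasurableSpace Ω] [MeasurableSpace E] {μ : Measure Ω}
  {pt : ℕ → Ω → E} {ν : Measure E}

/-- The infinite product `∏ⱼ (1 - φ(xⱼ))` is at most the product over the values `a` of `φ` of
`(1 - a)` to the number of points at which this value is taken. A value that is taken infinitely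
often contributes the factor `1` on the right, since `toNat ⊤ = 0`. -/
theorem iInf_prod_one_sub_le_prod_pow {Ω E : Type*} [MeasurableSpace E]
    {pt : ℕ → Ω → E} (φ : SimpleFunc E ℝ≥0∞) (R : Finset ℝ≥0∞) (ω : Ω) :
    ⨅ n, ∏ j ∈ Finset.range n, (1 - φ (pt j ω)) ≤
      ∏ a ∈ R, (1 - a) ^ (pointCount pt (φ ⁻¹' {a}) ω).toNat := by
  classical
  have hfin : ∀ a, ∃ F : Finset ℕ, (∀ j ∈ F, φ (pt j ω) = a) ∧
      F.card = (pointCount pt (φ ⁻¹' {a}) ω).toNat := by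
    intro a
    by_cases hf : {i : ℕ | pt i ω ∈ φ ⁻¹' {a}}.Finite
    · refine ⟨hf.toFinset, fun j hj => by simpa using hj, ?_⟩
      rw [pointCount, hf.encard_eq_coe_toFinset_card]
      simp
    · refine ⟨∅, by simp, ?_⟩
      rw [pointCount, Set.Infinite.encard_eq hf]
      simp
  choose F hF hcard using hfin
  obtain ⟨n, hn⟩ := (R.biUnion F).exists_nat_subset_range
  calc ⨅ n, ∏ j ∈ Finset.range n, (1 - φ (pt j ω))
      ≤ ∏ j ∈ Finset.range n, (1 - φ (pt j ω)) := iInf_le _ n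
    _ ≤ ∏ j ∈ R.biUnion F, (1 - φ (pt j ω)) :=
        Finset.prod_le_prod_of_subset_of_le_one' hn fun _ _ _ => tsub_le_self
    _ = ∏ a ∈ R, ∏ j ∈ F a, (1 - φ (pt j ω)) := by
        refine Finset.prod_biUnion fun a _ b _ hab => Finset.disjoint_left.2 fun j h1 h2 => ?_
        exact hab ((hF a j h1).symm.trans (hF b j h2))
    _ = ∏ a ∈ R, (1 - a) ^ (pointCount pt (φ ⁻¹' {a}) ω).toNat := by
        refine Finset.prod_congr rfl fun a _ => ?_
        rw [Finset.prod_congr rfl fun j hj => by rw [hF a j hj], Finset.prod_const, hcard]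

namespace IsPoissonProcess

theorem lintegral_pointCount_mul_iInf_prod_le_of_simpleFunc [IsProbabilityMeasure μ]
    (h : IsPoissonProcess pt ν μ) {C : Set E} (hC : MeasurableSet C) (hνC : ν C < ∞)
    (φ : SimpleFunc E ℝ≥0∞) (hφ1 : ∀ x, φ x ≤ 1) (hφC : ∀ x ∈ C, φ x = 0)
    (hφν : φ.lintegral ν ≠ ∞) :
    ∫⁻ ω, (pointCount pt C ω : ℕ∞) * ⨅ n, ∏ j ∈ Finset.range n, (1 - φ (pt j ω)) ∂μ ≤
      ν C * ENNReal.ofReal (Real.exp (-(φ.lintegral ν).toReal)) := by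
  classical
  set R : Finset ℝ≥0∞ := φ.range.erase 0 with hR
  have hR0 : ∀ a ∈ R, a ≠ 0 := fun a ha => (Finset.mem_erase.1 ha).1
  have hR1 : ∀ a ∈ R, a ≤ 1 := by
    intro a ha
    obtain ⟨x, rfl⟩ := SimpleFunc.mem_range.1 (Finset.mem_erase.1 ha).2
    exact hφ1 x
  have hint : φ.lintegral ν = ∑ a ∈ R, a * ν (φ ⁻¹' {a}) := by
    rw [SimpleFunc.lintegral, hR]
    refine (Finset.sum_subset (Finset.erase_subset _ _) fun a ha hna => ?_).symm
    have : a = 0 := by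
      by_contra h0
      exact hna (Finset.mem_erase.2 ⟨h0, ha⟩)
    simp [this]
  have hfin : ∀ a ∈ R, a * ν (φ ⁻¹' {a}) ≠ ∞ := by
    rw [hint] at hφν
    exact fun a ha => ENNReal.sum_ne_top.1 hφν a ha
  have hνa : ∀ a ∈ R, ν (φ ⁻¹' {a}) < ∞ := fun a ha =>
    ENNReal.lt_top_of_mul_ne_top_right (hfin a ha) (hR0 a ha)
  -- The set `C` and the level sets of `φ` at nonzero values are disjoint, so their counts are
  -- independent.
  let B : Option R → Set E := fun o => o.elim C fun a => φ ⁻¹' {(a : ℝ≥0∞)}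
  have hB : ∀ o, MeasurableSet (B o) := by
    rintro (_ | a)
    · exact hC
    · exact φ.measurableSet_preimage _
  have hd : Pairwise (Function.onFun Disjoint B) := by
    have h0 : ∀ a : R, Disjoint C (φ ⁻¹' {(a : ℝ≥0∞)}) := fun a =>
      Set.disjoint_left.2 fun x hx hxa => hR0 a a.2 (hxa.symm.trans (hφC x hx))
    rintro (_ | a) (_ | b) hab
    · exact absurd rfl hab
    · exact h0 b
    · exact (h0 a).symm
    · refine Set.disjoint_left.2 fun x hxa hxb => hab ?_
      exact congrArg some (Subtype.ext (hxa.symm.trans hxb))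
  let G : (o : Option R) → ℕ∞ → ℝ≥0∞ := fun o k => o.elim (k : ℝ≥0∞) fun a => (1 - a.1) ^ k.toNat
  have hind := lintegral_prod_eq_prod_lintegral_of_indepFun Finset.univ
    (fun o ω => G o (pointCount pt (B o) ω))
    ((h.iIndepFun_pointCount hB hd).comp G fun o => by fun_prop)
    (fun o => (Measurable.of_discrete (f := G o)).comp (measurable_pointCount h.measurable (hB o)))
  simp only [Fintype.prod_option] at hind
  calc ∫⁻ ω, (pointCount pt C ω : ℕ∞) * ⨅ n, ∏ j ∈ Finset.range n, (1 - φ (pt j ω)) ∂μ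
      ≤ ∫⁻ ω, (pointCount pt C ω : ℕ∞) *
          ∏ a : R, (1 - a.1) ^ (pointCount pt (φ ⁻¹' {a.1}) ω).toNat ∂μ := by
        refine lintegral_mono fun ω => mul_le_mul_right ?_ _
        rw [Finset.prod_coe_sort R fun a => (1 - a) ^ (pointCount pt (φ ⁻¹' {a}) ω).toNat]
        exact iInf_prod_one_sub_le_prod_pow φ R ω
    _ = (∫⁻ ω, (pointCount pt C ω : ℕ∞) ∂μ) *
          ∏ a : R, ∫⁻ ω, (1 - a.1) ^ (pointCount pt (φ ⁻¹' {a.1}) ω).toNat ∂μ := hind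
    _ = ν C * ∏ a : R, ENNReal.ofReal (Real.exp (-(a.1.toReal * (ν (φ ⁻¹' {a.1})).toReal))) := by
        rw [h.lintegral_pointCount hC hνC]
        congr 1
        refine Finset.prod_congr rfl fun a _ => ?_
        have ha := hR1 a a.2
        rw [← h.lintegral_pow_pointCount (φ.measurableSet_preimage _) (hνa a a.2)
          (a := a.1.toReal) (ENNReal.toReal_le_of_le_ofReal zero_le_one (by simpa using ha)),
          ENNReal.ofReal_sub _ ENNReal.toReal_nonneg, ENNReal.ofReal_one,
          ENNReal.ofReal_toReal (ne_top_of_le_ne_top ENNReal.one_ne_top ha)]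
    _ = ν C * ENNReal.ofReal (Real.exp (-(φ.lintegral ν).toReal)) := by
        rw [Finset.prod_coe_sort R fun a =>
            ENNReal.ofReal (Real.exp (-(a.toReal * (ν (φ ⁻¹' {a})).toReal))),
          ← ENNReal.ofReal_prod_of_nonneg (fun _ _ => (Real.exp_pos _).le), ← Real.exp_sum, hint,
          ENNReal.toReal_sum hfin, Finset.sum_neg_distrib]
        simp_rw [ENNReal.toReal_mul]

/-- The mean over the points in `C` of a product over the points outside `C` is bounded as if
the number of points in `C` and the configuration outside were independent; this is one half of
the formula for the Laplace functional. -/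
theorem lintegral_pointCount_mul_iInf_prod_le [IsProbabilityMeasure μ]
    (h : IsPoissonProcess pt ν μ) {C : Set E} (hC : MeasurableSet C) (hνC : ν C < ∞)
    {g : E → ℝ≥0∞} (hg : Measurable g) (hg1 : ∀ x, g x ≤ 1) (hgC : ∀ x ∈ C, g x = 0)
    (hgν : ∫⁻ x, g x ∂ν ≠ ∞) :
    ∫⁻ ω, (pointCount pt C ω : ℕ∞) * ⨅ n, ∏ j ∈ Finset.range n, (1 - g (pt j ω)) ∂μ ≤
      ν C * ENNReal.ofReal (Real.exp (-(∫⁻ x, g x ∂ν).toReal)) := by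
  have hle : ∀ n x, SimpleFunc.eapprox g n x ≤ g x := fun n x => by
    rw [← SimpleFunc.iSup_eapprox_apply hg x]
    exact le_iSup (fun n => SimpleFunc.eapprox g n x) n
  have hlim : Filter.Tendsto (fun n => (SimpleFunc.eapprox g n).lintegral ν) Filter.atTop
      (nhds (∫⁻ x, g x ∂ν)) := by
    rw [lintegral_eq_iSup_eapprox_lintegral hg]
    exact tendsto_atTop_iSup fun a b hab =>
      SimpleFunc.lintegral_mono (SimpleFunc.monotone_eapprox g hab) le_rfl
  have hfin : ∀ n, (SimpleFunc.eapprox g n).lintegral ν ≠ ∞ := fun n => by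
    rw [← SimpleFunc.lintegral_eq_lintegral]
    exact ne_top_of_le_ne_top hgν (lintegral_mono (hle n))
  have hlim' : Filter.Tendsto (fun n => ν C *
      ENNReal.ofReal (Real.exp (-((SimpleFunc.eapprox g n).lintegral ν).toReal))) Filter.atTop
      (nhds (ν C * ENNReal.ofReal (Real.exp (-(∫⁻ x, g x ∂ν).toReal)))) := by
    refine ENNReal.Tendsto.const_mul ?_ (Or.inr hνC.ne)
    refine ENNReal.tendsto_ofReal ((Real.continuous_exp.tendsto _).comp ?_)
    exact ((ENNReal.tendsto_toReal hgν).comp hlim).neg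
  refine ge_of_tendsto' hlim' fun n => ?_
  refine le_trans (lintegral_mono fun ω => ?_)
    (h.lintegral_pointCount_mul_iInf_prod_le_of_simpleFunc hC hνC (SimpleFunc.eapprox g n)
      (fun x => (hle n x).trans (hg1 x))
      (fun x hx => le_antisymm ((hle n x).trans (hgC x hx).le) bot_le) (hfin n))
  refine mul_le_mul_right (iInf_mono fun m => Finset.prod_le_prod' fun j _ => ?_) _
  exact tsub_le_tsub_left (hle n _) 1

end IsPoissonProcess

end LaplaceBound

/-! ### Link probabilities and their integrals -/

/-- The probability `exp (-t ‖x‖ ^ α)` that a link with displacement `x` and exponential fading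
has gain at least `t`. It vanishes at `x = 0`, in accordance with `0 ^ (-α) = 0`. -/
noncomputable def linkProb (α t : ℝ) (x : Plane) : ℝ≥0∞ :=
  if x = 0 then 0 else ENNReal.ofReal (Real.exp (-(t * ‖x‖ ^ α)))

theorem measurable_linkProb (α t : ℝ) : Measurable (linkProb α t) :=
  Measurable.ite (measurableSet_singleton 0) measurable_const (by fun_prop)

theorem linkProb_le_one {α t : ℝ} (ht : 0 ≤ t) (x : Plane) : linkProb α t x ≤ 1 := by
  rw [linkProb]
  split_ifs
  · exact zero_le_one
  · rw [ENNReal.ofReal_le_one, Real.exp_le_one_iff]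
    have := mul_nonneg ht (Real.rpow_nonneg (norm_nonneg x) α)
    linarith

theorem lintegral_exp_neg_mul_norm_rpow {α t : ℝ} (hα : 1 ≤ α) (ht : 0 < t) :
    ∫⁻ x : Plane, ENNReal.ofReal (Real.exp (-(t * ‖x‖ ^ α))) =
      ENNReal.ofReal (Real.pi * t ^ (-2 / α) * Real.Gamma (2 / α + 1)) := by
  have hmp := Complex.orthonormalBasisOneI.repr.symm.measurePreserving
  have hC := Complex.integral_exp_neg_mul_rpow hα ht
  have hpos : 0 < Real.pi * t ^ (-2 / α) * Real.Gamma (2 / α + 1) := by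
    have : 0 < Real.Gamma (2 / α + 1) := Real.Gamma_pos_of_pos (by positivity)
    have := Real.pi_pos
    positivity
  have hint : Integrable fun x : ℂ => Real.exp (-t * ‖x‖ ^ α) := by
    by_contra hn
    rw [integral_undef hn] at hC
    exact hpos.ne hC
  rw [← hC, ofReal_integral_eq_lintegral_ofReal hint (ae_of_all _ fun x => (Real.exp_pos _).le),
    ← hmp.lintegral_comp (by fun_prop)]
  simp only [LinearIsometryEquiv.norm_map, neg_mul]

theorem lintegral_linkProb {α t : ℝ} (hα : 1 ≤ α) (ht : 0 < t) :
    ∫⁻ x : Plane, linkProb α t x =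
      ENNReal.ofReal (Real.pi * t ^ (-2 / α) * Real.Gamma (2 / α + 1)) := by
  rw [← lintegral_exp_neg_mul_norm_rpow hα ht]
  refine lintegral_congr_ae ?_
  have : ∀ᵐ x : Plane, x ≠ 0 := by
    simp [ae_iff]
  filter_upwards [this] with x hx
  rw [linkProb, if_neg hx]

theorem tendsto_lintegral_exp_neg_mul_norm_add_rpow {α t : ℝ} (hα : 1 ≤ α) (ht : 0 < t) :
    Filter.Tendsto (fun n : ℕ => ∫⁻ x : Plane,
      ENNReal.ofReal (Real.exp (-(t * (‖x‖ + 1 / ((n : ℝ) + 1)) ^ α)))) Filter.atTop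
      (nhds (∫⁻ x : Plane, linkProb α t x)) := by
  rw [lintegral_linkProb hα ht, ← lintegral_exp_neg_mul_norm_rpow hα ht]
  refine lintegral_tendsto_of_tendsto_of_monotone (fun n => by fun_prop)
    (ae_of_all _ fun x m n hmn => ?_) (ae_of_all _ fun x => ?_)
  · refine ENNReal.ofReal_le_ofReal (Real.exp_le_exp.2 (neg_le_neg ?_))
    have := Nat.one_div_le_one_div (α := ℝ) hmn
    gcongr
  · refine ENNReal.tendsto_ofReal ((Real.continuous_exp.tendsto _).comp ?_)
    have h1 : Filter.Tendsto (fun n : ℕ => ‖x‖ + 1 / ((n : ℝ) + 1)) Filter.atTop (nhds ‖x‖) := by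
      simpa using tendsto_one_div_add_atTop_nhds_zero_nat.const_add ‖x‖
    exact ((h1.rpow_const (Or.inr (by linarith))).const_mul t).neg

/-! ### The reduced Palm distribution: an inequality of Mecke type -/

/-- For timers that are at most `s` with probability `s`: the probability that no `xⱼ` with
`j ≠ i` is at the same time a neighbor of `xᵢ` and the owner of a timer that is at most `s`. -/
noncomputable def isolationProb (α θ : ℝ) (s : ℝ≥0∞) (x : ℕ → Plane) (i : ℕ) : ℝ≥0∞ :=
  ⨅ n, ∏ j ∈ Finset.range n, if j = i then 1 else 1 - s * linkProb α θ (x i - x j)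

theorem measurable_isolationProb {Ω : Type*} [MeasurableSpace Ω] (α θ : ℝ) (i : ℕ) {s : Ω → ℝ≥0∞}
    (hs : Measurable s) {x : ℕ → Ω → Plane} (hx : ∀ j, Measurable (x j)) :
    Measurable fun ω => isolationProb α θ (s ω) (fun j => x j ω) i := by
  refine Measurable.iInf fun n => Finset.measurable_prod _ fun j _ => ?_
  split_ifs
  · exact measurable_const
  · exact measurable_const.sub (hs.mul ((measurable_linkProb α θ).comp ((hx i).sub (hx j))))

section Mecke

variable {Ω : Type*} [MeasurableSpace Ω] {μ : Measure Ω} [IsProbabilityMeasure μ]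
  {pt : ℕ → Ω → Plane} {l : ℝ≥0∞}

/-- For a point `xᵢ` in the ball around `c` of radius `ε`, the other points `xⱼ` are at distance
at most `‖c - xⱼ‖ + ε`; this bounds the isolation probability by a product that no longer depends
on `xᵢ`. Points in the cell `C` are dropped from the product, so coincident points play no role. -/
theorem tsum_lintegral_isolationProb_le_of_subset_ball
    (h : IsPoissonProcess pt (l • (volume : Measure Plane)) μ) (hl : l ≠ ∞)
    {α θ ε : ℝ} (hα : 1 ≤ α) (hθ : 0 < θ) (hε : 0 < ε) {s : ℝ≥0∞} (hs : s ≤ 1)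
    {C : Set Plane} (hC : MeasurableSet C) {c : Plane} (hCc : C ⊆ Metric.ball c ε) :
    ∑' i, ∫⁻ ω, C.indicator 1 (pt i ω) * isolationProb α θ s (fun j => pt j ω) i ∂μ ≤
      ENNReal.ofReal (Real.exp ((l * volume (Metric.ball (0 : Plane) ε)).toReal -
        (s * (l * ∫⁻ x : Plane, ENNReal.ofReal (Real.exp (-(θ * (‖x‖ + ε) ^ α))))).toReal)) *
      (l • (volume : Measure Plane)) C := by
  set ν : Measure Plane := l • volume with hν
  set k : Plane → ℝ≥0∞ := fun x => ENNReal.ofReal (Real.exp (-(θ * (‖x‖ + ε) ^ α))) with hk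
  have hkm : Measurable k := by fun_prop
  have hk1 : ∀ x, k x ≤ 1 := fun x => by
    rw [hk, ENNReal.ofReal_le_one, Real.exp_le_one_iff]
    have : 0 ≤ θ * (‖x‖ + ε) ^ α := by positivity
    linarith
  have hkfin : ∫⁻ x, k x ≠ ∞ := by
    refine ne_top_of_le_ne_top ?_ (lintegral_mono fun x => ENNReal.ofReal_le_ofReal
      (Real.exp_le_exp.2 (neg_le_neg (?_ : θ * ‖x‖ ^ α ≤ _))))
    · rw [lintegral_exp_neg_mul_norm_rpow hα hθ]
      exact ENNReal.ofReal_ne_top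
    · gcongr
      linarith
  set g : Plane → ℝ≥0∞ := Cᶜ.indicator fun y => s * k (c - y) with hg
  have hgm : Measurable g := Measurable.indicator (by fun_prop) hC.compl
  have hν_int : ∫⁻ y, s * k (c - y) ∂ν = s * (l * ∫⁻ x, k x) := by
    rw [lintegral_const_mul _ (by fun_prop), hν, lintegral_smul_measure,
      lintegral_sub_left_eq_self k c, smul_eq_mul]
  have hball : ν (Metric.ball c ε) = l * volume (Metric.ball (0 : Plane) ε) := by
    rw [hν, Measure.smul_apply, smul_eq_mul, Measure.addHaar_ball_center]
  have hballfin : l * volume (Metric.ball (0 : Plane) ε) ≠ ∞ :=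
    ENNReal.mul_ne_top hl measure_ball_lt_top.ne
  have hνC : ν C < ∞ := (measure_mono hCc).trans_lt (hball ▸ hballfin.lt_top)
  have hsfin : s * (l * ∫⁻ x, k x) ≠ ∞ :=
    ENNReal.mul_ne_top (ne_top_of_le_ne_top ENNReal.one_ne_top hs) (ENNReal.mul_ne_top hl hkfin)
  have hgfin : ∫⁻ x, g x ∂ν ≠ ∞ := by
    refine ne_top_of_le_ne_top (hν_int ▸ hsfin) (lintegral_mono fun x => ?_)
    exact Set.indicator_le_self _ _ x
  have hsplit : s * (l * ∫⁻ x, k x) ≤ l * volume (Metric.ball (0 : Plane) ε) + ∫⁻ x, g x ∂ν := by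
    rw [← hν_int, ← lintegral_add_compl _ hC, hg, lintegral_indicator hC.compl, ← hball]
    gcongr
    calc ∫⁻ y in C, s * k (c - y) ∂ν ≤ ∫⁻ y in C, 1 ∂ν :=
          lintegral_mono fun y => mul_le_one' hs (hk1 _)
      _ = ν C := by simp
      _ ≤ ν (Metric.ball c ε) := measure_mono hCc
  have hmain := h.lintegral_pointCount_mul_iInf_prod_le hC hνC hgm
    (fun x => Set.indicator_apply_le' (fun _ => mul_le_one' hs (hk1 _)) fun _ => zero_le_one)
    (fun x hx => Set.indicator_of_notMem (by simpa using hx) _) hgfin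
  have hWm : ∀ i, Measurable fun ω => isolationProb α θ s (fun j => pt j ω) i := fun i =>
    measurable_isolationProb α θ i measurable_const h.measurable
  have hCW : ∀ i, Measurable fun ω => C.indicator (1 : Plane → ℝ≥0∞) (pt i ω) *
      isolationProb α θ s (fun j => pt j ω) i := fun i =>
    ((measurable_one.indicator hC).comp (h.measurable i)).mul (hWm i)
  rw [← lintegral_tsum fun i => (hCW i).aemeasurable]
  calc ∫⁻ ω, ∑' i, C.indicator 1 (pt i ω) * isolationProb α θ s (fun j => pt j ω) i ∂μ
      ≤ ∫⁻ ω, (pointCount pt C ω : ℕ∞) * ⨅ n, ∏ j ∈ Finset.range n, (1 - g (pt j ω)) ∂μ := by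
        refine lintegral_mono fun ω => ?_
        rw [pointCount_eq_tsum, ← ENNReal.tsum_mul_right]
        refine ENNReal.tsum_le_tsum fun i => ?_
        by_cases hi : pt i ω ∈ C
        · refine mul_le_mul_right (iInf_mono fun n => Finset.prod_le_prod' fun j _ => ?_) _
          by_cases hj : pt j ω ∈ C
          · have : g (pt j ω) = 0 := Set.indicator_of_notMem (by simpa using hj) _
            rw [this, tsub_zero]
            split_ifs
            · exact le_rfl
            · exact tsub_le_self
          · have hij : j ≠ i := fun hij => hj (hij ▸ hi)
            have hne : pt i ω - pt j ω ≠ 0 := fun h0 => hj (sub_eq_zero.1 h0 ▸ hi)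
            rw [if_neg hij, hg, Set.indicator_of_mem (by simpa using hj), linkProb, if_neg hne]
            refine tsub_le_tsub_left (mul_le_mul_right (ENNReal.ofReal_le_ofReal
              (Real.exp_le_exp.2 (neg_le_neg ?_))) _) _
            have h1 : ‖pt i ω - pt j ω‖ ≤ ‖c - pt j ω‖ + ε := by
              have h2 := hCc hi
              rw [Metric.mem_ball, dist_eq_norm] at h2
              have h3 := norm_add_le (c - pt j ω) (pt i ω - c)
              rw [show c - pt j ω + (pt i ω - c) = pt i ω - pt j ω by abel] at h3
              linarith
            gcongr
        · simp [hi]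
    _ ≤ ν C * ENNReal.ofReal (Real.exp (-(∫⁻ x, g x ∂ν).toReal)) := hmain
    _ ≤ _ := by
        rw [mul_comm]
        gcongr
        have h4 := ENNReal.toReal_mono (ENNReal.add_ne_top.2 ⟨hballfin, hgfin⟩) hsplit
        rw [ENNReal.toReal_add hballfin hgfin] at h4
        linarith

/-- Seen from a point `X` of the process, the other points form the same Poisson process, so
`X` is isolated with probability at most `exp (-s λ ∫ linkProb)`. The bound on cells of radius `ε`
is summed over a partition, and then `ε` tends to `0`. -/
theorem sum_map_withDensity_isolationProb_le
    (h : IsPoissonProcess pt (l • (volume : Measure Plane)) μ) (hl : l ≠ ∞)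
    {α θ : ℝ} (hα : 1 ≤ α) (hθ : 0 < θ) {s : ℝ≥0∞} (hs : s ≤ 1) :
    Measure.sum (fun i => (μ.withDensity fun ω =>
        isolationProb α θ s (fun j => pt j ω) i).map (pt i)) ≤
      ENNReal.ofReal (Real.exp (-(s * (l * ∫⁻ x : Plane, linkProb α θ x)).toReal)) •
        (l • (volume : Measure Plane)) := by
  set ν : Measure Plane := l • volume with hν
  set M := Measure.sum (fun i => (μ.withDensity fun ω =>
        isolationProb α θ s (fun j => pt j ω) i).map (pt i)) with hM
  have hWm : ∀ i, Measurable fun ω => isolationProb α θ s (fun j => pt j ω) i := fun i =>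
    measurable_isolationProb α θ i measurable_const h.measurable
  have hMC : ∀ C, MeasurableSet C → M C =
      ∑' i, ∫⁻ ω, C.indicator 1 (pt i ω) * isolationProb α θ s (fun j => pt j ω) i ∂μ := by
    intro C hC
    rw [hM, Measure.sum_apply _ hC]
    refine tsum_congr fun i => ?_
    rw [Measure.map_apply (h.measurable i) hC, withDensity_apply _ (h.measurable i hC),
      ← lintegral_indicator (h.measurable i hC)]
    refine lintegral_congr fun ω => ?_
    by_cases hω : pt i ω ∈ C <;> simp [hω]
  set e : ℝ → ℝ≥0∞ := fun ε =>
    ENNReal.ofReal (Real.exp ((l * volume (Metric.ball (0 : Plane) ε)).toReal -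
      (s * (l * ∫⁻ x : Plane, ENNReal.ofReal (Real.exp (-(θ * (‖x‖ + ε) ^ α))))).toReal)) with he
  have hstep : ∀ ε > 0, M ≤ e ε • ν := by
    refine fun ε hε => Measure.le_intro fun B hB _ => ?_
    set D : ℕ → Set Plane :=
      fun n => B ∩ disjointed (fun n => Metric.ball (TopologicalSpace.denseSeq Plane n) ε) n
    have hDm : ∀ n, MeasurableSet (D n) := fun n =>
      hB.inter (MeasurableSet.disjointed (fun _ => measurableSet_ball) n)
    have hDd : Pairwise (Function.onFun Disjoint D) := fun a b hab =>
      ((disjoint_disjointed _) hab).mono Set.inter_subset_right Set.inter_subset_right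
    have hDU : ⋃ n, D n = B := by
      rw [← Set.inter_iUnion, iUnion_disjointed, Set.inter_eq_left]
      intro x _
      obtain ⟨n, hn⟩ := (TopologicalSpace.denseRange_denseSeq Plane).exists_dist_lt x hε
      exact Set.mem_iUnion.2 ⟨n, hn⟩
    rw [← hDU, measure_iUnion hDd hDm, measure_iUnion hDd hDm]
    refine ENNReal.tsum_le_tsum fun n => ?_
    rw [hMC _ (hDm n), Measure.smul_apply, smul_eq_mul]
    exact tsum_lintegral_isolationProb_le_of_subset_ball h hl hα hθ hε hs (hDm n)
      (Set.inter_subset_right.trans (disjointed_subset _ n))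
  have hlim : Filter.Tendsto (fun n : ℕ => e (1 / ((n : ℝ) + 1))) Filter.atTop
      (nhds (ENNReal.ofReal (Real.exp (-(s * (l * ∫⁻ x : Plane, linkProb α θ x)).toReal)))) := by
    refine ENNReal.tendsto_ofReal ((Real.continuous_exp.tendsto _).comp ?_)
    rw [← zero_sub]
    have hs' : s ≠ ∞ := ne_top_of_le_ne_top ENNReal.one_ne_top hs
    refine Filter.Tendsto.sub ?_ ?_
    · simp_rw [Measure.addHaar_ball (volume : Measure Plane) 0 Nat.one_div_pos_of_nat.le,
        ENNReal.toReal_mul]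
      rw [show (0 : ℝ) = l.toReal * ((0 : ℝ) ^ 2 * (volume (Metric.ball (0 : Plane) 1)).toReal) by
        simp]
      refine Filter.Tendsto.const_mul _ (Filter.Tendsto.mul_const _ ?_)
      refine Filter.Tendsto.congr (fun n => ?_)
        (tendsto_one_div_add_atTop_nhds_zero_nat.pow 2)
      rw [ENNReal.toReal_ofReal (by positivity), finrank_euclideanSpace_fin]
    · refine (ENNReal.tendsto_toReal (ENNReal.mul_ne_top hs' (ENNReal.mul_ne_top hl ?_))).comp ?_
      · rw [lintegral_linkProb hα hθ]
        exact ENNReal.ofReal_ne_top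
      · exact ENNReal.Tendsto.const_mul (ENNReal.Tendsto.const_mul
          (tendsto_lintegral_exp_neg_mul_norm_add_rpow hα hθ) (Or.inr hl)) (Or.inr hs')
  refine Measure.le_intro fun B hB _ => ?_
  by_cases hB0 : ν B = ∞
  · rw [Measure.smul_apply, hB0, smul_eq_mul, ENNReal.mul_top]
    · exact le_top
    · simp [Real.exp_pos]
  · rw [Measure.smul_apply, smul_eq_mul]
    refine ge_of_tendsto' (ENNReal.Tendsto.mul_const hlim (Or.inr hB0)) fun n => ?_
    exact hstep _ Nat.one_div_pos_of_nat B

/-- The preceding inequality, integrated against a weight `f` of the point. -/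
theorem tsum_lintegral_mul_isolationProb_le
    (h : IsPoissonProcess pt (l • (volume : Measure Plane)) μ) (hl : l ≠ ∞)
    {α θ : ℝ} (hα : 1 ≤ α) (hθ : 0 < θ) {s : ℝ≥0∞} (hs : s ≤ 1)
    {f : Plane → ℝ≥0∞} (hf : Measurable f) :
    ∑' i, ∫⁻ ω, f (pt i ω) * isolationProb α θ s (fun j => pt j ω) i ∂μ ≤
      ENNReal.ofReal (Real.exp (-(s * (l * ∫⁻ x : Plane, linkProb α θ x)).toReal)) *
        (l * ∫⁻ x : Plane, f x) := by
  have hWm : ∀ i, Measurable fun ω => isolationProb α θ s (fun j => pt j ω) i := fun i =>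
    measurable_isolationProb α θ i measurable_const h.measurable
  have h1 := lintegral_mono' (sum_map_withDensity_isolationProb_le h hl hα hθ hs) (le_refl f)
  rw [lintegral_sum_measure, lintegral_smul_measure, lintegral_smul_measure, smul_eq_mul,
    smul_eq_mul] at h1
  refine le_trans (ENNReal.tsum_le_tsum fun i => le_of_eq ?_) h1
  rw [lintegral_map hf (h.measurable i),
    lintegral_withDensity_eq_lintegral_mul (g := fun ω => f (pt i ω)) _ (hWm i)
      (hf.comp (h.measurable i))]
  refine lintegral_congr fun ω => ?_
  simp [mul_comm]

end Mecke

/-! ### Independence and conditioning -/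

section Independence

variable {Ω A B : Type*} [MeasurableSpace Ω] [MeasurableSpace A] [MeasurableSpace B]
  {μ : Measure Ω} [IsProbabilityMeasure μ]

/-- Conditioning on `X` when `Y` is independent of `X`: the value of `X` is frozen and `Y` is
sampled anew. -/
theorem measure_prodMk_mem_eq_lintegral {X : Ω → A} {Y : Ω → B} (hX : Measurable X)
    (hY : Measurable Y) (h : IndepFun X Y μ) {S : Set (A × B)} (hS : MeasurableSet S) :
    μ {ω | (X ω, Y ω) ∈ S} = ∫⁻ ω, μ {ω' | (X ω, Y ω') ∈ S} ∂μ := by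
  have h1 := (indepFun_iff_map_prod_eq_prod_map_map hX.aemeasurable hY.aemeasurable).1 h
  have h2 : μ {ω | (X ω, Y ω) ∈ S} = μ.map (fun ω => (X ω, Y ω)) S :=
    (Measure.map_apply (hX.prodMk hY) hS).symm
  rw [h2, h1, Measure.prod_apply hS, lintegral_map (measurable_measure_prodMk_left hS) hX]
  exact lintegral_congr fun ω => Measure.map_apply hY (measurable_prodMk_left hS)

theorem measurable_measure_prodMk_mem {X : Ω → A} {Y : Ω → B} (hX : Measurable X)
    (hY : Measurable Y) {S : Set (A × B)} (hS : MeasurableSet S) :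
    Measurable fun ω => μ {ω' | (X ω, Y ω') ∈ S} := by
  have h1 : Measurable fun ω => μ.map Y (Prod.mk (X ω) ⁻¹' S) :=
    (measurable_measure_prodMk_left hS).comp hX
  convert h1 using 2 with ω
  exact (Measure.map_apply hY (measurable_prodMk_left hS)).symm

theorem iIndepFun_curry {ι κ : Type*} {X : ι × κ → Ω → A} (hX : ∀ p, Measurable (X p))
    (h : iIndepFun X μ) : iIndepFun (fun i ω k => X (i, k) ω) μ := by
  have : ∀ p, IsProbabilityMeasure (μ.map (X p)) :=
    fun p => Measure.isProbabilityMeasure_map (hX p).aemeasurable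
  have hm : ∀ i, Measurable fun ω k => X (i, k) ω := fun i => measurable_pi_lambda _ fun k => hX _
  rw [iIndepFun_iff_map_fun_eq_infinitePi_map hm]
  have h1 := (iIndepFun_iff_map_fun_eq_infinitePi_map hX).1 h
  have h2 := Measure.infinitePi_map_curry fun i k => μ.map (X (i, k))
  rw [← h1, Measure.map_map (by fun_prop) (measurable_pi_lambda _ hX)] at h2
  refine h2.trans (congrArg _ (funext fun i => ?_))
  have hi : Function.Injective fun k : κ => (i, k) := fun a b hab => (Prod.mk.inj hab).2
  exact ((iIndepFun_iff_map_fun_eq_infinitePi_map fun k => hX (i, k)).1 (h.precomp hi)).symm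

theorem iIndepFun_bool {U V : Ω → A} (h : IndepFun U V μ) :
    iIndepFun (fun b : Bool => if b then U else V) μ := by
  rw [iIndepFun_iff_measure_inter_preimage_eq_mul]
  intro S s hs
  have hS : S = ∅ ∨ S = {true} ∨ S = {false} ∨ S = {true, false} := by
    clear hs
    decide +revert
  rcases hS with rfl | rfl | rfl | rfl
  · simp
  · simp
  · simp
  · rw [Finset.set_biInter_insert, Finset.set_biInter_singleton, Finset.prod_pair (by simp)]
    exact h.measure_inter_preimage_eq_mul _ _ (hs true (by simp)) (hs false (by simp))

/-- If two families of independent variables are independent of each other, then the pairs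
`(Uᵢ, Vᵢ)` are independent. The pairs are encoded as functions on `Bool`. -/
theorem iIndepFun_pair {ι : Type*} {U V : ι → Ω → A} (hU : ∀ i, Measurable (U i))
    (hV : ∀ i, Measurable (V i)) (hUi : iIndepFun U μ) (hVi : iIndepFun V μ)
    (hUV : IndepFun (fun ω i => U i ω) (fun ω i => V i ω) μ) :
    iIndepFun (fun i ω (b : Bool) => if b then U i ω else V i ω) μ := by
  let X : Bool → ι → Ω → A := fun b i => if b then U i else V i
  have hX : ∀ b i, Measurable (X b i) := by
    rintro (_ | _) i
    · exact hV i
    · exact hU i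
  have h1 : iIndepFun (fun b ω => (X b · ω)) μ := by
    refine (iIndepFun_bool hUV).congr fun b => ?_
    cases b <;> exact Filter.EventuallyEq.rfl
  have h2 : ∀ b, iIndepFun (X b) μ := by
    rintro (_ | _)
    · exact hVi
    · exact hUi
  have h3 := (iIndepFun_uncurry' hX h1 h2).precomp (Equiv.prodComm ι Bool).injective
  refine (iIndepFun_curry (X := fun p : ι × Bool => X p.2 p.1) (fun p => hX _ _) h3).congr
    fun i => Filter.Eventually.of_forall fun ω => funext fun b => ?_
  cases b <;> rfl

theorem indepFun_prodMk_of_indepFun {F : Type*} [MeasurableSpace F] {X : Ω → A} {Y : Ω → B}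
    {W : Ω → F} (hX : Measurable X) (hY : Measurable Y) (hW : Measurable W)
    (h1 : IndepFun X (fun ω => (Y ω, W ω)) μ) (h2 : IndepFun Y W μ) :
    IndepFun (fun ω => (X ω, Y ω)) W μ := by
  have e1 := (indepFun_iff_map_prod_eq_prod_map_map hX.aemeasurable
    (hY.prodMk hW).aemeasurable).1 h1
  have e2 := (indepFun_iff_map_prod_eq_prod_map_map hY.aemeasurable hW.aemeasurable).1 h2
  have e3 := (indepFun_iff_map_prod_eq_prod_map_map hX.aemeasurable hY.aemeasurable).1
    (h1.comp measurable_id measurable_fst)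
  have : IsProbabilityMeasure (μ.map X) := Measure.isProbabilityMeasure_map hX.aemeasurable
  have : IsProbabilityMeasure (μ.map Y) := Measure.isProbabilityMeasure_map hY.aemeasurable
  have : IsProbabilityMeasure (μ.map W) := Measure.isProbabilityMeasure_map hW.aemeasurable
  rw [indepFun_iff_map_prod_eq_prod_map_map (hX.prodMk hY).aemeasurable hW.aemeasurable]
  rw [e2, ← Measure.prodAssoc_prod] at e1
  have e4 := congrArg (Measure.map MeasurableEquiv.prodAssoc.symm) e1
  rw [MeasurableEquiv.map_symm_map,
    Measure.map_map (MeasurableEquiv.measurable _) (hX.prodMk (hY.prodMk hW))] at e4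
  have e3' : μ.map (fun ω => (X ω, Y ω)) = (μ.map X).prod (μ.map Y) := e3
  rw [e3', ← e4]
  rfl

/-! ### Repeated trials given a common random environment -/

/-- Given the environment `Z`, the trials `τ k` are independent and succeed with the same
probability `q(Z)`, so that `n` of them fail with probability `(1 - q(Z)) ^ n`. -/
theorem measure_forall_notMem_eq_lintegral_pow {Z : Ω → A} {τ : ℕ → Ω → B} (hZ : Measurable Z)
    (hτ : ∀ k, Measurable (τ k)) (hind : iIndepFun τ μ) (hlaw : ∀ k, μ.map (τ k) = μ.map (τ 0))
    (hZτ : IndepFun Z (fun ω k => τ k ω) μ) {D : Set A} (hD : MeasurableSet D)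
    {S : Set (A × B)} (hS : MeasurableSet S) (n : ℕ) :
    μ {ω | Z ω ∈ D ∧ ∀ k < n, (Z ω, τ k ω) ∉ S} =
      ∫⁻ ω in Z ⁻¹' D, (1 - μ {ω' | (Z ω, τ 0 ω') ∈ S}) ^ n ∂μ := by
  have hτ' : Measurable fun ω k => τ k ω := measurable_pi_lambda _ hτ
  let R : Set (A × (ℕ → B)) := {p | p.1 ∈ D ∧ ∀ k < n, (p.1, p.2 k) ∉ S}
  have hR : MeasurableSet R := by
    have : R = Prod.fst ⁻¹' D ∩
        ⋂ k, ⋂ (_ : k < n), ((fun p : A × (ℕ → B) => (p.1, p.2 k)) ⁻¹' S)ᶜ := by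
      ext p
      simp [R]
    rw [this]
    refine (measurable_fst hD).inter (MeasurableSet.iInter fun k => MeasurableSet.iInter fun _ => ?_)
    exact ((measurable_fst.prodMk ((measurable_pi_apply k).comp measurable_snd)) hS).compl
  have h1 := measure_prodMk_mem_eq_lintegral hZ hτ' hZτ hR
  refine h1.trans ?_
  rw [← lintegral_indicator (hZ hD)]
  refine lintegral_congr fun ω => ?_
  by_cases hω : Z ω ∈ D
  · rw [Set.indicator_of_mem (s := Z ⁻¹' D) hω]
    have hSω : MeasurableSet {b | (Z ω, b) ∈ S} := measurable_prodMk_left hS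
    have h2 : {ω' | (Z ω, fun k => τ k ω') ∈ R} =
        ⋂ k ∈ Finset.range n, τ k ⁻¹' {b | (Z ω, b) ∈ S}ᶜ := by
      ext ω'
      simp [R, hω]
    rw [h2, hind.measure_inter_preimage_eq_mul _ fun k _ => hSω.compl]
    have h3 : ∀ k, μ (τ k ⁻¹' {b | (Z ω, b) ∈ S}ᶜ) = 1 - μ {ω' | (Z ω, τ 0 ω') ∈ S} := by
      intro k
      rw [← Measure.map_apply (hτ k) hSω.compl, hlaw k, Measure.map_apply (hτ 0) hSω.compl,
        Set.preimage_compl, prob_compl_eq_one_sub (hτ 0 hSω)]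
      rfl
    simp_rw [h3]
    simp
  · rw [Set.indicator_of_notMem (s := Z ⁻¹' D) hω]
    simp [R, hω]

theorem pow_add_mul_sub_le_pow {a b : ℝ} (ha : 0 ≤ a) (hb : 0 ≤ b) (n : ℕ) :
    b ^ (n + 1) + (n + 1) * b ^ n * (a - b) ≤ a ^ (n + 1) := by
  induction n with
  | zero => simp
  | succ n ih =>
    have h1 := mul_le_mul_of_nonneg_left ih ha
    have h2 : 0 ≤ ((n : ℝ) + 1) * b ^ n * (a - b) ^ 2 := by positivity
    push_cast
    calc b ^ (n + 1 + 1) + ((n : ℝ) + 1 + 1) * b ^ (n + 1) * (a - b)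
        = a * (b ^ (n + 1) + (n + 1) * b ^ n * (a - b)) - (n + 1) * b ^ n * (a - b) ^ 2 := by ring
      _ ≤ a * a ^ (n + 1) := by linarith
      _ = a ^ (n + 1 + 1) := by ring

/-- The tangent line of the convex function `q ↦ (1 - q) ^ n` at `p`, without negative terms. -/
theorem one_sub_pow_tangent {p q : ℝ≥0∞} (hp : p ≤ 1) (hq : q ≤ 1) (n : ℕ) :
    (1 - p) ^ n + n * (1 - p) ^ (n - 1) * p ≤ (1 - q) ^ n + n * (1 - p) ^ (n - 1) * q := by
  rcases n with _ | n
  · simp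
  lift p to NNReal using ne_top_of_le_ne_top ENNReal.one_ne_top hp
  lift q to NNReal using ne_top_of_le_ne_top ENNReal.one_ne_top hq
  rw [Nat.add_sub_cancel]
  norm_cast at hp hq ⊢
  rw [← NNReal.coe_le_coe]
  push_cast [NNReal.coe_sub hp, NNReal.coe_sub hq]
  have hp' : (p : ℝ) ≤ 1 := by exact_mod_cast hp
  have hq' : (q : ℝ) ≤ 1 := by exact_mod_cast hq
  have := pow_add_mul_sub_le_pow (sub_nonneg.2 hq') (sub_nonneg.2 hp') n
  linarith

/-- Jensen's inequality for repeated trials in a random environment, averaged over a countable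
family of events `Dᵢ` of finite total mass: if a single trial succeeds with average probability at
most `p`, then `n` trials all fail with average probability at least `(1 - p) ^ n`. -/
theorem tsum_mul_one_sub_pow_le {Z : Ω → A} {τ : ℕ → Ω → B} (hZ : Measurable Z)
    (hτ : ∀ k, Measurable (τ k)) (hind : iIndepFun τ μ) (hlaw : ∀ k, μ.map (τ k) = μ.map (τ 0))
    (hZτ : IndepFun Z (fun ω k => τ k ω) μ) {D : ℕ → Set A} (hD : ∀ i, MeasurableSet (D i))
    {S : ℕ → Set (A × B)} (hS : ∀ i, MeasurableSet (S i)) {p : ℝ≥0∞} (hp : p ≤ 1)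
    (hc : ∑' i, μ (Z ⁻¹' D i) ≠ ∞)
    (hT : ∑' i, μ {ω | Z ω ∈ D i ∧ (Z ω, τ 0 ω) ∈ S i} ≤ (∑' i, μ (Z ⁻¹' D i)) * p) (n : ℕ) :
    (∑' i, μ (Z ⁻¹' D i)) * (1 - p) ^ n ≤
      ∑' i, μ {ω | Z ω ∈ D i ∧ ∀ k < n, (Z ω, τ k ω) ∉ S i} := by
  set c := ∑' i, μ (Z ⁻¹' D i)
  set K : ℝ≥0∞ := n * (1 - p) ^ (n - 1)
  have hp1 : 1 - p ≠ ∞ := ENNReal.sub_ne_top ENNReal.one_ne_top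
  have hK : K ≠ ∞ := ENNReal.mul_ne_top (ENNReal.natCast_ne_top n) (ENNReal.pow_ne_top hp1)
  let q : ℕ → Ω → ℝ≥0∞ := fun i ω => μ {ω' | (Z ω, τ 0 ω') ∈ S i}
  have hq : ∀ i, Measurable (q i) := fun i => measurable_measure_prodMk_mem hZ (hτ 0) (hS i)
  have hT' : ∀ i, μ {ω | Z ω ∈ D i ∧ (Z ω, τ 0 ω) ∈ S i} = ∫⁻ ω in Z ⁻¹' D i, q i ω ∂μ := by
    intro i
    have h1 := measure_prodMk_mem_eq_lintegral hZ (hτ 0)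
      (hZτ.comp measurable_id (measurable_pi_apply 0))
      ((measurable_fst (hD i)).inter (hS i))
    refine h1.trans ?_
    rw [← lintegral_indicator (hZ (hD i))]
    refine lintegral_congr fun ω => ?_
    by_cases hω : Z ω ∈ D i
    · rw [Set.indicator_of_mem (s := Z ⁻¹' D i) hω]
      simp [q, hω]
    · rw [Set.indicator_of_notMem (s := Z ⁻¹' D i) hω]
      simp [hω]
  have hle : c * (1 - p) ^ n + K * (c * p) ≤
      (∑' i, μ {ω | Z ω ∈ D i ∧ ∀ k < n, (Z ω, τ k ω) ∉ S i}) + K * (c * p) := by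
    calc c * (1 - p) ^ n + K * (c * p) = ∑' i, μ (Z ⁻¹' D i) * ((1 - p) ^ n + K * p) := by
          rw [ENNReal.tsum_mul_right]
          ring
      _ = ∑' i, ∫⁻ _ in Z ⁻¹' D i, ((1 - p) ^ n + K * p) ∂μ := by
          refine tsum_congr fun i => ?_
          rw [setLIntegral_const, mul_comm]
      _ ≤ ∑' i, ∫⁻ ω in Z ⁻¹' D i, ((1 - q i ω) ^ n + K * q i ω) ∂μ :=
          ENNReal.tsum_le_tsum fun i => lintegral_mono fun ω =>
            one_sub_pow_tangent hp prob_le_one n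
      _ = ∑' i, (μ {ω | Z ω ∈ D i ∧ ∀ k < n, (Z ω, τ k ω) ∉ S i} +
            K * μ {ω | Z ω ∈ D i ∧ (Z ω, τ 0 ω) ∈ S i}) := by
          refine tsum_congr fun i => ?_
          rw [lintegral_add_right _ ((hq i).const_mul K), lintegral_const_mul _ (hq i), hT' i,
            measure_forall_notMem_eq_lintegral_pow hZ hτ hind hlaw hZτ (hD i) (hS i) n]
      _ ≤ _ := by
          rw [ENNReal.tsum_add, ENNReal.tsum_mul_left]
          gcongr
  exact (ENNReal.add_le_add_iff_right (ENNReal.mul_ne_top hK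
    (ENNReal.mul_ne_top hc (ne_top_of_le_ne_top ENNReal.one_ne_top hp)))).1 hle

end Independence

/-! ### Links with exponential fading -/

theorem expMeasure_one_Ici {t : ℝ} (ht : 0 ≤ t) :
    expMeasure 1 (Set.Ici t) = ENNReal.ofReal (Real.exp (-t)) := by
  have := isProbabilityMeasure_expMeasure one_pos
  have hna : NullSingletonClass (expMeasure 1) :=
    inferInstanceAs (NullSingletonClass (volume.withDensity (gammaPDF 1 1)))
  have h1 := cdf_expMeasure_eq one_pos t
  rw [if_pos ht, cdf_eq_real, one_mul] at h1
  rw [← ofReal_measureReal (measure_ne_top _ _), ← measureReal_congr Ioi_ae_eq_Ici,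
    ← Set.compl_Iic, probReal_compl_eq_one_sub measurableSet_Iic, h1]
  congr 1
  ring

theorem expMeasure_one_gain_ge {α t : ℝ} (hα : 0 < α) (ht : 0 < t) (x : Plane) :
    expMeasure 1 {g | t ≤ g * ‖x‖ ^ (-α)} = linkProb α t x := by
  rw [linkProb]
  split_ifs with hx
  · rw [hx, norm_zero, Real.zero_rpow (by linarith)]
    simp [not_le.2 ht]
  · have hpos : 0 < ‖x‖ ^ α := Real.rpow_pos_of_pos (norm_pos_iff.2 hx) _
    rw [← expMeasure_one_Ici (by positivity)]
    congr 1
    ext g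
    rw [Set.mem_ofPred_eq, Set.mem_Ici, Real.rpow_neg (norm_nonneg x), ← div_eq_mul_inv,
      le_div_iff₀ hpos]

/-! ### The network as a function of locations, fading gains and timers -/

/-- The location of a node, as a function of the points of the process. -/
def nodeLoc (x : ℕ → Plane) : Node → Plane
  | none => 0
  | some i => x i

/-- The channel gain between two nodes, as a function of the points and the fading gains. -/
noncomputable def linkGain (α : ℝ) (z : (ℕ → Plane) × (Sym2 Node → ℝ)) (i j : Node) : ℝ :=
  z.2 s(i, j) * dist (nodeLoc z.1 i) (nodeLoc z.1 j) ^ (-α)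

theorem measurable_nodeLoc (i : Node) : Measurable fun x : ℕ → Plane => nodeLoc x i := by
  cases i with
  | none => exact measurable_const
  | some i => exact measurable_pi_apply i

theorem measurable_linkGain (α : ℝ) (i j : Node) : Measurable fun z => linkGain α z i j := by
  have h : ∀ i : Node, Measurable fun z : (ℕ → Plane) × (Sym2 Node → ℝ) => nodeLoc z.1 i :=
    fun i => (measurable_nodeLoc i).comp measurable_fst
  exact ((measurable_pi_apply s(i, j)).comp measurable_snd).mul (((h i).dist (h j)).pow_const _)

/-- The environments and timers for which the gain from the node `some i` to the typical node is
at least `t` and the node `some i` transmits. -/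
def strongTransmission (α θ t : ℝ) (i : ℕ) :
    Set (((ℕ → Plane) × (Sym2 Node → ℝ)) × (Node → ℝ)) :=
  {p | t ≤ linkGain α p.1 none (some i) ∧
    ∀ j, j ≠ some i ∧ θ ≤ linkGain α p.1 (some i) j → p.2 (some i) < p.2 j}

theorem measurableSet_strongTransmission (α θ t : ℝ) (i : ℕ) :
    MeasurableSet (strongTransmission α θ t i) := by
  have hg : ∀ j j' : Node, Measurable
      fun p : ((ℕ → Plane) × (Sym2 Node → ℝ)) × (Node → ℝ) => linkGain α p.1 j j' :=
    fun j j' => (measurable_linkGain α j j').comp measurable_fst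
  have ht : ∀ j : Node, Measurable
      fun p : ((ℕ → Plane) × (Sym2 Node → ℝ)) × (Node → ℝ) => p.2 j :=
    fun j => (measurable_pi_apply j).comp measurable_snd
  have h := MeasurableSet.iInter fun j : Node =>
    ((MeasurableSet.const (j ≠ some i)).inter (measurableSet_le (measurable_const (a := θ))
      (hg (some i) j))).imp (measurableSet_lt (ht (some i)) (ht j))
  rw [← Set.ofPred_forall] at h
  exact (measurableSet_le measurable_const (hg _ _)).inter h

namespace Network

variable {Ω : Type*} [MeasurableSpace Ω] {μ : Measure Ω} {lam : ℝ} (N : Network μ lam)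

/-- The random environment, which stays fixed over the frames: locations and fading gains. -/
def environment (ω : Ω) : (ℕ → Plane) × (Sym2 Node → ℝ) :=
  (fun i => N.pt i ω, fun e => N.fading e ω)

theorem loc_eq_nodeLoc (ω : Ω) (i : Node) : N.loc ω i = nodeLoc (fun j => N.pt j ω) i := by
  cases i <;> rfl

theorem gain_eq_linkGain (α : ℝ) (ω : Ω) (i j : Node) :
    N.gain α ω i j = linkGain α (N.environment ω) i j := by
  rw [gain, linkGain, loc_eq_nodeLoc, loc_eq_nodeLoc]
  rfl

theorem measurable_pt : Measurable fun ω i => N.pt i ω :=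
  measurable_pi_lambda _ N.poisson.measurable

theorem measurable_fading : Measurable fun ω e => N.fading e ω :=
  measurable_pi_lambda _ N.fading_measurable

theorem measurable_timer : Measurable fun ω (p : ℕ × Node) => N.timer p.1 p.2 ω :=
  measurable_pi_lambda _ fun p => N.timer_measurable p.1 p.2

theorem measurable_environment : Measurable N.environment :=
  N.measurable_pt.prodMk N.measurable_fading

theorem measurable_frame (k : ℕ) : Measurable fun ω i => N.timer k i ω :=
  measurable_pi_lambda _ fun i => N.timer_measurable k i

theorem measurable_gain (α : ℝ) (i j : Node) : Measurable fun ω => N.gain α ω i j := by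
  simp_rw [gain_eq_linkGain]
  exact (measurable_linkGain α i j).comp N.measurable_environment

theorem measure_gain_ge {α t : ℝ} (hα : 0 < α) (ht : 0 < t) (e : Sym2 Node) (x : Plane) :
    μ {ω | t ≤ N.fading e ω * ‖x‖ ^ (-α)} = linkProb α t x := by
  rw [← expMeasure_one_gain_ge hα ht x, ← N.fading_law e, Measure.map_apply (N.fading_measurable e)
    (measurableSet_le measurable_const (by fun_prop))]
  rfl

theorem measure_timer_le (k : ℕ) (j : Node) {s : ℝ} (hs : s ∈ Set.Icc (0 : ℝ) 1) :
    μ {ω | N.timer k j ω ≤ s} = ENNReal.ofReal s := by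
  have h1 : μ {ω | N.timer k j ω ≤ s} = μ.map (N.timer k j) (Set.Iic s) :=
    (Measure.map_apply (N.timer_measurable k j) measurableSet_Iic).symm
  have h2 : Set.Iic s ∩ Set.Icc 0 1 = Set.Icc 0 s := by
    ext y
    simp only [Set.mem_inter_iff, Set.mem_Iic, Set.mem_Icc]
    exact ⟨fun h => ⟨h.2.1, h.1⟩, fun h => ⟨h.2, h.1, h.2.trans hs.2⟩⟩
  rw [h1, N.timer_law, Measure.restrict_apply measurableSet_Iic, h2, Real.volume_Icc, sub_zero]

theorem indepFun_fading_timer (e : Sym2 Node) (k : ℕ) (j : Node) :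
    IndepFun (N.fading e) (N.timer k j) μ :=
  N.fading_timer_indep.comp (φ := fun f : Sym2 Node → ℝ => f e)
    (ψ := fun t : ℕ × Node → ℝ => t (k, j))
    (measurable_pi_apply _) (measurable_pi_apply _)

variable [IsProbabilityMeasure μ]

theorem indepFun_environment_timer :
    IndepFun N.environment (fun ω k i => N.timer k i ω) μ := by
  have h1 := indepFun_prodMk_of_indepFun N.measurable_pt N.measurable_fading N.measurable_timer
    N.pt_mark_indep N.fading_timer_indep
  exact h1.comp (φ := id) (ψ := fun t k i => t (k, i)) measurable_id
    (measurable_pi_lambda _ fun k => measurable_pi_lambda _ fun i => measurable_pi_apply (k, i))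

theorem iIndepFun_frame : iIndepFun (fun k ω i => N.timer k i ω) μ :=
  iIndepFun_curry (X := fun p : ℕ × Node => N.timer p.1 p.2) (fun _ => N.timer_measurable _ _)
    N.timer_indep

theorem map_frame (k : ℕ) :
    μ.map (fun ω i => N.timer k i ω) =
      Measure.infinitePi fun _ : Node => (volume : Measure ℝ).restrict (Set.Icc 0 1) := by
  have hk : Function.Injective fun i : Node => (k, i) := fun a b hab => (Prod.mk.inj hab).2
  have h1 := (iIndepFun_iff_map_fun_eq_infinitePi_map
    fun i => N.timer_measurable k i).1 (N.timer_indep.precomp (g := fun i : Node => (k, i)) hk)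
  simpa only [N.timer_law] using h1

theorem iIndepFun_fading_timer (i : Node) :
    iIndepFun (fun j ω (b : Bool) => if b then N.fading s(i, j) ω else N.timer 0 j ω) μ := by
  have h0 : Function.Injective fun j : Node => ((0 : ℕ), j) := fun a b hab => (Prod.mk.inj hab).2
  have hi : Function.Injective fun j : Node => s(i, j) := fun a b hab => Sym2.congr_right.1 hab
  refine iIndepFun_pair (fun j => N.fading_measurable _) (fun j => N.timer_measurable 0 j)
    (N.fading_indep.precomp (g := fun j : Node => s(i, j)) hi)
    (N.timer_indep.precomp (g := fun j : Node => ((0 : ℕ), j)) h0) ?_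
  exact N.fading_timer_indep.comp (φ := fun f j => f s(i, j)) (ψ := fun t j => t (0, j))
    (measurable_pi_lambda _ fun j => measurable_pi_apply _)
    (measurable_pi_lambda _ fun j => measurable_pi_apply _)

theorem measure_gain_ge_and_lt_timer {α t : ℝ} (hα : 0 < α) (ht : 0 < t) (e : Sym2 Node)
    (x : Plane) (k : ℕ) (j : Node) {s : ℝ} (hs : s ∈ Set.Icc (0 : ℝ) 1) :
    μ {ω | t ≤ N.fading e ω * ‖x‖ ^ (-α) ∧ s < N.timer k j ω} =
      linkProb α t x * (1 - ENNReal.ofReal s) := by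
  have h1 := (N.indepFun_fading_timer e k j).measure_inter_preimage_eq_mul
    {g | t ≤ g * ‖x‖ ^ (-α)} (Set.Iic s)ᶜ (measurableSet_le measurable_const (by fun_prop))
    measurableSet_Iic.compl
  rw [Set.preimage_compl, prob_compl_eq_one_sub (N.timer_measurable k j measurableSet_Iic)] at h1
  rw [← N.measure_gain_ge hα ht e x, ← N.measure_timer_le k j hs]
  convert! h1 using 2
  ext ω
  simp

theorem measure_gain_ge_imp_lt_timer {α t : ℝ} (hα : 0 < α) (ht : 0 < t) (e : Sym2 Node)
    (x : Plane) (k : ℕ) (j : Node) {s : ℝ} (hs : s ∈ Set.Icc (0 : ℝ) 1) :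
    μ {ω | t ≤ N.fading e ω * ‖x‖ ^ (-α) → s < N.timer k j ω} =
      1 - ENNReal.ofReal s * linkProb α t x := by
  have hm : MeasurableSet {g : ℝ | t ≤ g * ‖x‖ ^ (-α)} :=
    measurableSet_le measurable_const (by fun_prop)
  have h1 := (N.indepFun_fading_timer e k j).measure_inter_preimage_eq_mul
    {g | t ≤ g * ‖x‖ ^ (-α)} (Set.Iic s) hm measurableSet_Iic
  rw [← N.measure_gain_ge hα ht e x, ← N.measure_timer_le k j hs, mul_comm]
  refine Eq.trans ?_ (congrArg (1 - ·) h1)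
  rw [← prob_compl_eq_one_sub ((N.fading_measurable e hm).inter
    (N.timer_measurable k j measurableSet_Iic))]
  congr 1
  ext ω
  simp

end Network

/-! ### The probability of a strong transmission -/

namespace Network

variable {Ω : Type*} [MeasurableSpace Ω] {μ : Measure Ω} {lam : ℝ} (N : Network μ lam)

theorem lintegral_comp_timer (k : ℕ) (i : Node) {h : ℝ → ℝ≥0∞} (hh : Measurable h) :
    ∫⁻ ω, h (N.timer k i ω) ∂μ = ∫⁻ s in Set.Icc 0 1, h s := by
  rw [← lintegral_map hh (N.timer_measurable k i), N.timer_law]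

theorem ae_timer_mem_Icc (k : ℕ) (i : Node) : ∀ᵐ ω ∂μ, N.timer k i ω ∈ Set.Icc (0 : ℝ) 1 := by
  have h1 : ∀ᵐ s ∂(μ.map (N.timer k i)), s ∈ Set.Icc (0 : ℝ) 1 := by
    rw [N.timer_law]
    exact ae_restrict_mem measurableSet_Icc
  exact ae_of_ae_map (N.timer_measurable k i).aemeasurable h1

variable [IsProbabilityMeasure μ]

/-- For frozen locations `x`: given the timer `s` of the node `some i`, each further node spoils
its transmission independently of the others, by being a neighbor with a timer at most `s`. Only
the nodes of index below `n` and the typical node are taken into account. -/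
theorem measure_strongTransmission_le_lintegral_prod {α θ t : ℝ} (hα : 0 < α) (hθ : 0 < θ)
    (hθt : θ ≤ t) (x : ℕ → Plane) (i n : ℕ) :
    μ {ω | ((x, fun e => N.fading e ω), fun j => N.timer 0 j ω) ∈ strongTransmission α θ t i} ≤
      ∫⁻ s in Set.Icc (0 : ℝ) 1, linkProb α t (x i) * (1 - ENNReal.ofReal s) *
        ∏ j ∈ Finset.range n, if j = i then 1 else
          1 - ENNReal.ofReal s * linkProb α θ (x i - x j) := by
  classical
  let Y : Node → Ω → Bool → ℝ := fun j ω b => if b then N.fading s(some i, j) ω else N.timer 0 j ω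
  have hYm : ∀ j, Measurable (Y j) := fun j => measurable_pi_lambda _ fun b => by
    cases b
    · exact N.timer_measurable 0 j
    · exact N.fading_measurable _
  have hYi : iIndepFun Y μ := N.iIndepFun_fading_timer (some i)
  let F : Finset Node := insert none (((Finset.range n).erase i).map Function.Embedding.some)
  have hiF : (some i) ∉ F := by simp [F]
  -- `G j` holds the pairs (own timer, fading and timer of node `j`) for which `j` is harmless.
  let G : Node → Set (ℝ × (Bool → ℝ)) := fun j => match j with
    | none => {p | t ≤ p.2 true * ‖x i‖ ^ (-α) ∧ p.1 < p.2 false}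
    | some j => {p | θ ≤ p.2 true * ‖x i - x j‖ ^ (-α) → p.1 < p.2 false}
  have hGm : ∀ j, MeasurableSet (G j) := by
    have h1 : Measurable fun p : ℝ × (Bool → ℝ) => p.2 true :=
      (measurable_pi_apply true).comp measurable_snd
    have h2 : Measurable fun p : ℝ × (Bool → ℝ) => p.2 false :=
      (measurable_pi_apply false).comp measurable_snd
    rintro (_ | j)
    · exact (measurableSet_le measurable_const (h1.mul_const _)).inter
        (measurableSet_lt measurable_fst h2)
    · exact (measurableSet_le measurable_const (h1.mul_const _)).imp
        (measurableSet_lt measurable_fst h2)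
  have hsub : {ω | ((x, fun e => N.fading e ω), fun j => N.timer 0 j ω) ∈
      strongTransmission α θ t i} ⊆ {ω | ∀ j ∈ F, (N.timer 0 (some i) ω, Y j ω) ∈ G j} := by
    rintro ω ⟨h1, h2⟩ j hj
    have hgain : ∀ j, linkGain α (x, fun e => N.fading e ω) (some i) j =
      N.fading s(some i, j) ω * ‖x i - nodeLoc x j‖ ^ (-α) := fun j => by
        rw [linkGain, dist_eq_norm]; rfl
    rcases j with _ | j
    · have h3 : t ≤ linkGain α (x, fun e => N.fading e ω) (some i) none := by
        rw [linkGain] at h1 ⊢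
        rwa [Sym2.eq_swap, dist_comm]
      have h4 := hgain none
      rw [nodeLoc, sub_zero] at h4
      exact ⟨h4 ▸ h3, h2 none ⟨by simp, hθt.trans h3⟩⟩
    · have hji : (some j : Node) ≠ some i := fun h => hiF (h ▸ hj)
      exact fun h5 => h2 (some j) ⟨hji, (hgain (some j)).symm ▸ h5⟩
  let S : Set (ℝ × (F → Bool → ℝ)) := ⋂ j : F, (fun p => (p.1, p.2 j)) ⁻¹' G j
  have hSm : MeasurableSet S := MeasurableSet.iInter fun j =>
    (measurable_fst.prodMk ((measurable_pi_apply j).comp measurable_snd)) (hGm j)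
  have hind : IndepFun (N.timer 0 (some i)) (fun ω (j : F) => Y j ω) μ :=
    (hYi.indepFun_finset {some i} F (by simpa using hiF) hYm).comp
      (φ := fun y : ({some i} : Finset Node) → Bool → ℝ => y ⟨some i, by simp⟩ false) (ψ := id)
      ((measurable_pi_apply false).comp (measurable_pi_apply (X := fun _ => Bool → ℝ) _))
      measurable_id
  have hdec := measure_prodMk_mem_eq_lintegral (N.timer_measurable 0 (some i))
    (measurable_pi_lambda _ fun j : F => hYm j) hind hSm
  have hlink : Measurable fun s : ℝ => linkProb α t (x i) * (1 - ENNReal.ofReal s) *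
        ∏ j ∈ Finset.range n, if j = i then 1 else
          1 - ENNReal.ofReal s * linkProb α θ (x i - x j) := by
    refine Measurable.mul (by fun_prop) (Finset.measurable_prod _ fun j _ => ?_)
    split_ifs <;> fun_prop
  refine (measure_mono hsub).trans (le_of_eq ?_)
  rw [← N.lintegral_comp_timer 0 (some i) hlink]
  have hS : {ω | ∀ j ∈ F, (N.timer 0 (some i) ω, Y j ω) ∈ G j} =
      {ω | (N.timer 0 (some i) ω, fun j : F => Y j ω) ∈ S} := by
    ext ω
    simp [S]
  rw [hS, hdec]
  refine lintegral_congr_ae ?_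
  filter_upwards [N.ae_timer_mem_Icc 0 (some i)] with ω hω
  set s := N.timer 0 (some i) ω with hs
  have hprod : μ {ω' | (s, fun j : F => Y j ω') ∈ S} = ∏ j ∈ F, μ {ω' | (s, Y j ω') ∈ G j} := by
    have h1 := hYi.measure_inter_preimage_eq_mul F (sets := fun j => Prod.mk s ⁻¹' G j)
      fun j _ => measurable_prodMk_left (hGm j)
    refine Eq.trans ?_ h1
    congr 1
    ext ω'
    simp [S]
  rw [hprod, Finset.prod_insert (by simp), Finset.prod_map]
  congr 1
  · exact N.measure_gain_ge_and_lt_timer hα (hθ.trans_le hθt) s(some i, none) (x i) 0 none hω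
  · have h2 : ∀ j, μ {ω' | (s, Y (some j) ω') ∈ G (some j)} =
        1 - ENNReal.ofReal s * linkProb α θ (x i - x j) := fun j =>
      N.measure_gain_ge_imp_lt_timer hα hθ s(some i, some j) (x i - x j) 0 (some j) hω
    refine (Finset.prod_congr rfl fun j _ => h2 j).trans ?_
    rw [← Finset.prod_subset (Finset.erase_subset i (Finset.range n))]
    · refine Finset.prod_congr rfl fun j hj => ?_
      rw [if_neg (Finset.ne_of_mem_erase hj)]
    · intro j hj hji
      rw [if_pos]
      by_contra hne
      exact hji (Finset.mem_erase.2 ⟨hne, hj⟩)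

theorem measure_strongTransmission_le_lintegral {α θ t : ℝ} (hα : 0 < α) (hθ : 0 < θ)
    (hθt : θ ≤ t) (x : ℕ → Plane) (i : ℕ) :
    μ {ω | ((x, fun e => N.fading e ω), fun j => N.timer 0 j ω) ∈ strongTransmission α θ t i} ≤
      ∫⁻ s in Set.Icc (0 : ℝ) 1, linkProb α t (x i) * (1 - ENNReal.ofReal s) *
        isolationProb α θ (ENNReal.ofReal s) x i := by
  have ht : 0 < t := hθ.trans_le hθt
  have hle : ∀ s : ℝ, linkProb α t (x i) * (1 - ENNReal.ofReal s) ≤ 1 := fun s =>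
    mul_le_one' (linkProb_le_one ht.le _) tsub_le_self
  have h1 : ∀ s : ℝ, linkProb α t (x i) * (1 - ENNReal.ofReal s) *
      isolationProb α θ (ENNReal.ofReal s) x i = ⨅ n, linkProb α t (x i) * (1 - ENNReal.ofReal s) *
        ∏ j ∈ Finset.range n, if j = i then 1 else
          1 - ENNReal.ofReal s * linkProb α θ (x i - x j) := fun s =>
    ENNReal.mul_iInf fun h => absurd h (ne_top_of_le_ne_top ENNReal.one_ne_top (hle s))
  simp_rw [h1]
  rw [lintegral_iInf]
  · exact le_iInf fun n => N.measure_strongTransmission_le_lintegral_prod hα hθ hθt x i n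
  · intro n
    refine Measurable.mul (by fun_prop) (Finset.measurable_prod _ fun j _ => ?_)
    split_ifs <;> fun_prop
  · intro m n hmn s
    refine mul_le_mul_right (Finset.prod_le_prod_of_subset_of_le_one' (by simpa using hmn)
      fun j _ _ => ?_) _
    split_ifs
    · exact le_rfl
    · exact tsub_le_self
  · refine ne_top_of_le_ne_top ?_ (lintegral_mono fun s => ?_) (b := ∫⁻ _ in Set.Icc (0 : ℝ) 1, 1)
    · simp
    · simpa using hle s

/-- The integral of `1 - s`, the probability that the typical node has a timer above `s`, against
`exp (-s c)`, the probability that no other node spoils the transmission. -/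
theorem lintegral_one_sub_mul_exp {c : ℝ} (hc : 0 < c) :
    ∫⁻ s in Set.Icc (0 : ℝ) 1, (1 - ENNReal.ofReal s) * ENNReal.ofReal (Real.exp (-(s * c))) =
      ENNReal.ofReal ((Real.exp (-c) + c - 1) / c ^ 2) := by
  have hderiv : ∀ s ∈ Set.uIcc (0 : ℝ) 1, HasDerivAt
      (fun s : ℝ => Real.exp (-(s * c)) * ((1 - c * (1 - s)) / c ^ 2))
      ((1 - s) * Real.exp (-(s * c))) s := by
    intro s _
    have h1 : HasDerivAt (fun s : ℝ => Real.exp (-(s * c))) (Real.exp (-(s * c)) * -(1 * c)) s :=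
      (((hasDerivAt_id s).mul_const c).neg).exp
    have h2 : HasDerivAt (fun s : ℝ => (1 - c * (1 - s)) / c ^ 2) (-(c * -1) / c ^ 2) s :=
      (((((hasDerivAt_id s).const_sub 1).const_mul c).const_sub 1).div_const (c ^ 2))
    refine (h1.mul h2).congr_deriv ?_
    field_simp
    ring
  have hint : IntervalIntegrable (fun s : ℝ => (1 - s) * Real.exp (-(s * c))) volume 0 1 :=
    (by fun_prop : Continuous fun s : ℝ => (1 - s) * Real.exp (-(s * c))).intervalIntegrable 0 1
  have hval := intervalIntegral.integral_eq_sub_of_hasDerivAt hderiv hint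
  rw [intervalIntegral.integral_of_le zero_le_one, ← integral_Icc_eq_integral_Ioc] at hval
  have hI : IntegrableOn (fun s : ℝ => (1 - s) * Real.exp (-(s * c))) (Set.Icc 0 1) :=
    (by fun_prop : Continuous fun s : ℝ => (1 - s) * Real.exp (-(s * c))).integrableOn_Icc
  calc ∫⁻ s in Set.Icc (0 : ℝ) 1, (1 - ENNReal.ofReal s) * ENNReal.ofReal (Real.exp (-(s * c)))
      = ∫⁻ s in Set.Icc (0 : ℝ) 1, ENNReal.ofReal ((1 - s) * Real.exp (-(s * c))) := by
        refine setLIntegral_congr_fun measurableSet_Icc fun s hs => ?_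
        rw [ENNReal.ofReal_mul (sub_nonneg.2 hs.2), ENNReal.ofReal_sub _ hs.1, ENNReal.ofReal_one]
    _ = ENNReal.ofReal (∫ s in Set.Icc (0 : ℝ) 1, (1 - s) * Real.exp (-(s * c))) := by
        refine (ofReal_integral_eq_lintegral_ofReal hI ?_).symm
        refine (ae_restrict_iff' measurableSet_Icc).2 (ae_of_all _ fun s hs => ?_)
        exact mul_nonneg (sub_nonneg.2 hs.2) (Real.exp_pos _).le
    _ = _ := by
        rw [hval]
        congr 1
        simp only [one_mul, zero_mul, neg_zero, Real.exp_zero, sub_self, mul_zero, sub_zero,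
          mul_one]
        field_simp
        ring

theorem neighborConst_eq {α : ℝ} (hα : 0 < α) (lam θ : ℝ) :
    neighborConst lam α θ = lam * (Real.pi * θ ^ (-2 / α) * Real.Gamma (2 / α + 1)) := by
  rw [neighborConst, Real.Gamma_add_one (by positivity)]
  ring

theorem lintegral_linkProb_eq_neighborConst {α t : ℝ} (hα : 1 ≤ α) (ht : 0 < t) (hlam : 0 ≤ lam) :
    ENNReal.ofReal lam * ∫⁻ x : Plane, linkProb α t x = ENNReal.ofReal (neighborConst lam α t) := by
  rw [lintegral_linkProb hα ht, neighborConst_eq (by linarith), ENNReal.ofReal_mul hlam]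

theorem neighborConst_pos {α t : ℝ} (hα : 0 < α) (ht : 0 < t) (hlam : 0 < lam) :
    0 < neighborConst lam α t := by
  have := Real.Gamma_pos_of_pos (s := 2 / α) (by positivity)
  have := Real.pi_pos
  rw [neighborConst]
  positivity

/-- The mean number of nodes that have gain at least `t` to the typical node and transmit is at
most the mean number `neighborConst lam α t` of nodes with such a gain, times the probability
`∫₀¹ (1 - s) exp (-s c) ds` of transmission. -/
theorem tsum_measure_strongTransmission_le {α θ t : ℝ} (hlam : 0 < lam) (hα : 1 ≤ α) (hθ : 0 < θ)
    (hθt : θ ≤ t) :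
    ∑' i, μ {ω | (N.environment ω, fun j => N.timer 0 j ω) ∈ strongTransmission α θ t i} ≤
      ENNReal.ofReal (neighborConst lam α t) * ENNReal.ofReal
        ((Real.exp (-neighborConst lam α θ) + neighborConst lam α θ - 1) /
          neighborConst lam α θ ^ 2) := by
  have hα0 : 0 < α := by linarith
  have ht : 0 < t := hθ.trans_le hθt
  have hc := neighborConst_pos hα0 hθ hlam
  have hstep : ∀ i, μ {ω | (N.environment ω, fun j => N.timer 0 j ω) ∈
      strongTransmission α θ t i} ≤ ∫⁻ ω, (∫⁻ s in Set.Icc (0 : ℝ) 1,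
        linkProb α t (N.pt i ω) * (1 - ENNReal.ofReal s) *
          isolationProb α θ (ENNReal.ofReal s) (fun j => N.pt j ω) i) ∂μ := by
    intro i
    let S : Set ((ℕ → Plane) × ((Sym2 Node → ℝ) × (ℕ × Node → ℝ))) :=
      (fun p => ((p.1, p.2.1), fun j => p.2.2 (0, j))) ⁻¹' strongTransmission α θ t i
    have hS : MeasurableSet S := by
      refine Measurable.prodMk (by fun_prop) ?_ (measurableSet_strongTransmission α θ t i)
      exact measurable_pi_lambda _ fun j =>
        (measurable_pi_apply (0, j)).comp (measurable_snd.comp measurable_snd)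
    have h1 := measure_prodMk_mem_eq_lintegral N.measurable_pt
      (N.measurable_fading.prodMk N.measurable_timer) N.pt_mark_indep hS
    refine h1.trans_le (lintegral_mono fun ω => ?_)
    exact N.measure_strongTransmission_le_lintegral hα0 hθ hθt (fun j => N.pt j ω) i
  have hWm : ∀ i, Measurable fun p : Ω × ℝ => linkProb α t (N.pt i p.1) *
      (1 - ENNReal.ofReal p.2) *
      isolationProb α θ (ENNReal.ofReal p.2) (fun j => N.pt j p.1) i := by
    intro i
    have hpt : ∀ j, Measurable fun p : Ω × ℝ => N.pt j p.1 := fun j =>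
      (N.poisson.measurable j).comp measurable_fst
    have hs : Measurable fun p : Ω × ℝ => ENNReal.ofReal p.2 := by fun_prop
    exact (((measurable_linkProb α t).comp (hpt i)).mul (hs.const_sub 1)).mul
      (measurable_isolationProb α θ i hs hpt)
  calc ∑' i, μ {ω | (N.environment ω, fun j => N.timer 0 j ω) ∈ strongTransmission α θ t i}
      ≤ ∑' i, ∫⁻ ω, (∫⁻ s in Set.Icc (0 : ℝ) 1,
        linkProb α t (N.pt i ω) * (1 - ENNReal.ofReal s) *
          isolationProb α θ (ENNReal.ofReal s) (fun j => N.pt j ω) i) ∂μ :=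
        ENNReal.tsum_le_tsum hstep
    _ = ∑' i, ∫⁻ s in Set.Icc (0 : ℝ) 1, ∫⁻ ω,
        linkProb α t (N.pt i ω) * (1 - ENNReal.ofReal s) *
          isolationProb α θ (ENNReal.ofReal s) (fun j => N.pt j ω) i ∂μ :=
        tsum_congr fun i => lintegral_lintegral_swap (hWm i).aemeasurable
    _ = ∫⁻ s in Set.Icc (0 : ℝ) 1, ∑' i, ∫⁻ ω,
        linkProb α t (N.pt i ω) * (1 - ENNReal.ofReal s) *
          isolationProb α θ (ENNReal.ofReal s) (fun j => N.pt j ω) i ∂μ :=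
        (lintegral_tsum fun i => (hWm i).lintegral_prod_left'.aemeasurable).symm
    _ ≤ ∫⁻ s in Set.Icc (0 : ℝ) 1, ENNReal.ofReal (neighborConst lam α t) *
        ((1 - ENNReal.ofReal s) * ENNReal.ofReal (Real.exp (-(s * neighborConst lam α θ)))) := by
        refine setLIntegral_mono' measurableSet_Icc fun s hs => ?_
        have h2 := tsum_lintegral_mul_isolationProb_le N.poisson ENNReal.ofReal_ne_top hα hθ
          (s := ENNReal.ofReal s) (ENNReal.ofReal_le_one.2 hs.2) (measurable_linkProb α t)
        rw [lintegral_linkProb_eq_neighborConst hα hθ hlam.le,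
          lintegral_linkProb_eq_neighborConst hα ht hlam.le, ← ENNReal.ofReal_mul hs.1,
          ENNReal.toReal_ofReal (mul_nonneg hs.1 hc.le)] at h2
        calc ∑' i, ∫⁻ ω, linkProb α t (N.pt i ω) * (1 - ENNReal.ofReal s) *
              isolationProb α θ (ENNReal.ofReal s) (fun j => N.pt j ω) i ∂μ
            = (1 - ENNReal.ofReal s) * ∑' i, ∫⁻ ω, linkProb α t (N.pt i ω) *
              isolationProb α θ (ENNReal.ofReal s) (fun j => N.pt j ω) i ∂μ := by
              rw [← ENNReal.tsum_mul_left]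
              refine tsum_congr fun i => ?_
              rw [← lintegral_const_mul' _ _ (ENNReal.sub_ne_top ENNReal.one_ne_top)]
              refine lintegral_congr fun ω => ?_
              ring
          _ ≤ (1 - ENNReal.ofReal s) *
              (ENNReal.ofReal (Real.exp (-(s * neighborConst lam α θ))) *
                ENNReal.ofReal (neighborConst lam α t)) := by gcongr
          _ = _ := by ring
    _ = _ := by
        rw [lintegral_const_mul' _ _ ENNReal.ofReal_ne_top, lintegral_one_sub_mul_exp hc]

end Network

/-! ### Neighbors, failures and the error probability -/

namespace Network

variable {Ω : Type*} [MeasurableSpace Ω] {μ : Measure Ω} {lam : ℝ} (N : Network μ lam)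

theorem measurableSet_isNeighbor (α θ : ℝ) (i : ℕ) :
    MeasurableSet {ω | N.IsNeighbor α θ ω none (some i)} :=
  (MeasurableSet.const _).inter (measurableSet_le measurable_const (N.measurable_gain α _ _))

/-- A received message was sent over a link of gain at least `δ / γ`: interference only lowers
the SINR. -/
theorem Received.mem_strongTransmission {α θ γ δ : ℝ} (hγ : 0 < γ) (hδ : 0 < δ) {k : ℕ} {ω : Ω}
    {i : ℕ} (h : N.Received α θ γ δ k ω i) :
    (N.environment ω, fun j => N.timer k j ω) ∈ strongTransmission α θ (δ / γ) i := by
  refine ⟨?_, fun j hj => h.1 j ?_⟩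
  · rw [← gain_eq_linkGain]
    have h1 : ENNReal.ofReal δ ≤ ENNReal.ofReal (γ * N.gain α ω none (some i)) :=
      h.2.trans (ENNReal.div_le_of_le_mul (le_mul_of_one_le_right' le_add_self))
    have h2 : δ ≤ γ * N.gain α ω none (some i) := by
      by_contra hlt
      exact absurd h1 (not_le.2 ((ENNReal.ofReal_lt_ofReal_iff hδ).2 (not_le.1 hlt)))
    rwa [div_le_iff₀' hγ]
  · rw [IsNeighbor, gain_eq_linkGain]
    exact hj

theorem meanNeighbors_eq_tsum (α θ : ℝ) :
    N.meanNeighbors α θ = ∑' i, μ {ω | N.IsNeighbor α θ ω none (some i)} :=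
  lintegral_encard_setOf (N.measurableSet_isNeighbor α θ)

theorem meanMissed_le_meanNeighbors (α θ γ δ : ℝ) (n : ℕ) :
    N.meanMissed α θ γ δ n ≤ N.meanNeighbors α θ :=
  lintegral_mono fun _ => ENat.toENNReal_mono (Set.encard_le_encard fun _ hi => hi.1)

variable [IsProbabilityMeasure μ]

theorem measure_isNeighbor {α θ : ℝ} (hα : 0 < α) (hθ : 0 < θ) (i : ℕ) :
    μ {ω | N.IsNeighbor α θ ω none (some i)} = ∫⁻ ω, linkProb α θ (N.pt i ω) ∂μ := by
  let S : Set (Plane × ℝ) := {p | θ ≤ p.2 * ‖p.1‖ ^ (-α)}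
  have hS : MeasurableSet S :=
    measurableSet_le measurable_const (measurable_snd.mul (measurable_fst.norm.pow_const _))
  have hind : IndepFun (N.pt i) (N.fading s(none, some i)) μ :=
    N.pt_mark_indep.comp (φ := fun x : ℕ → Plane => x i)
      (ψ := fun m : (Sym2 Node → ℝ) × (ℕ × Node → ℝ) => m.1 s(none, some i))
      (measurable_pi_apply i) ((measurable_pi_apply _).comp measurable_fst)
  have h1 := measure_prodMk_mem_eq_lintegral (N.poisson.measurable i) (N.fading_measurable _)
    hind hS
  have h2 : {ω | N.IsNeighbor α θ ω none (some i)} =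
      {ω | (N.pt i ω, N.fading s(none, some i) ω) ∈ S} := by
    ext ω
    simp [IsNeighbor, gain, loc, S, dist_eq_norm]
  rw [h2, h1]
  exact lintegral_congr fun ω => N.measure_gain_ge hα hθ _ _

theorem meanNeighbors_eq {α θ : ℝ} (hlam : 0 < lam) (hα : 1 ≤ α) (hθ : 0 < θ) :
    N.meanNeighbors α θ = ENNReal.ofReal (neighborConst lam α θ) := by
  have hα0 : 0 < α := by linarith
  have : SigmaFinite (ENNReal.ofReal lam • (volume : Measure Plane)) :=
    SMul.sigmaFinite lam.toNNReal
  have h1 : ∑' i, ∫⁻ ω, linkProb α θ (N.pt i ω) ∂μ =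
      ∫⁻ x, linkProb α θ x ∂(ENNReal.ofReal lam • (volume : Measure Plane)) := by
    rw [← N.poisson.sum_map_eq, lintegral_sum_measure]
    exact tsum_congr fun i =>
      (lintegral_map (measurable_linkProb α θ) (N.poisson.measurable i)).symm
  rw [meanNeighbors_eq_tsum, tsum_congr (N.measure_isNeighbor hα0 hθ), h1, lintegral_smul_measure,
    smul_eq_mul, lintegral_linkProb_eq_neighborConst hα hθ hlam.le]

/-- The mean number of neighbors that succeed in one frame, relative to the mean number of
neighbors. A neighbor with gain at least `t` has gain at least `max θ t`, and the threshold may be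
lowered to `t` again once the fraction of such neighbors is computed. -/
theorem tsum_measure_isNeighbor_inter_le {α θ t p : ℝ} (hlam : 0 < lam) (hα : 1 ≤ α) (hθ : 0 < θ)
    (ht : 0 < t) (hp : (θ / t) ^ (2 / α) *
      ((Real.exp (-neighborConst lam α θ) + neighborConst lam α θ - 1) /
        neighborConst lam α θ ^ 2) ≤ p) :
    ∑' i, μ {ω | N.IsNeighbor α θ ω none (some i) ∧
        (N.environment ω, fun j => N.timer 0 j ω) ∈ strongTransmission α θ t i} ≤
      N.meanNeighbors α θ * ENNReal.ofReal (min 1 p) := by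
  have hα0 : 0 < α := by linarith
  have hc := neighborConst_pos hα0 hθ hlam
  have hexp : 0 ≤ (Real.exp (-neighborConst lam α θ) + neighborConst lam α θ - 1) /
      neighborConst lam α θ ^ 2 := by
    have := Real.add_one_le_exp (-neighborConst lam α θ)
    exact div_nonneg (by linarith) (by positivity)
  rw [ENNReal.ofReal_min, mul_min, ENNReal.ofReal_one, mul_one]
  refine le_min ?_ ?_
  · rw [meanNeighbors_eq_tsum]
    exact ENNReal.tsum_le_tsum fun i => measure_mono fun ω hω => hω.1
  · -- The threshold `max θ t` makes the typical node a neighbor of the transmitter.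
    have htt : t ≤ max θ t := le_max_right _ _
    calc ∑' i, μ {ω | N.IsNeighbor α θ ω none (some i) ∧
          (N.environment ω, fun j => N.timer 0 j ω) ∈ strongTransmission α θ t i}
        ≤ ∑' i, μ {ω | (N.environment ω, fun j => N.timer 0 j ω) ∈
            strongTransmission α θ (max θ t) i} := by
          refine ENNReal.tsum_le_tsum fun i => measure_mono fun ω hω => ?_
          refine ⟨max_le ?_ hω.2.1, hω.2.2⟩
          rw [← gain_eq_linkGain]
          exact hω.1.2
      _ ≤ _ := N.tsum_measure_strongTransmission_le hlam hα hθ (le_max_left _ _)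
      _ ≤ N.meanNeighbors α θ * ENNReal.ofReal p := by
          rw [N.meanNeighbors_eq hlam hα hθ,
            ← ENNReal.ofReal_mul (neighborConst_pos hα0 (lt_max_of_lt_left hθ) hlam).le,
            ← ENNReal.ofReal_mul hc.le]
          refine ENNReal.ofReal_le_ofReal ?_
          have h1 : neighborConst lam α (max θ t) ≤ neighborConst lam α t := by
            have hΓ := Real.Gamma_pos_of_pos (s := 2 / α) (by positivity)
            have hpow : max θ t ^ (-2 / α) ≤ t ^ (-2 / α) :=
              Real.rpow_le_rpow_of_nonpos ht htt (div_nonpos_of_nonpos_of_nonneg (by norm_num)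
                hα0.le)
            have := Real.pi_pos
            unfold neighborConst
            gcongr
          have h2 : neighborConst lam α t = neighborConst lam α θ * (θ / t) ^ (2 / α) := by
            have h3 : θ ^ (-2 / α) * θ ^ (2 / α) = 1 := by
              rw [← Real.rpow_add hθ, neg_div, neg_add_cancel, Real.rpow_zero]
            have h4 : t ^ (-2 / α) = (t ^ (2 / α))⁻¹ := by rw [neg_div, Real.rpow_neg ht.le]
            rw [neighborConst, neighborConst, Real.div_rpow hθ.le ht.le, h4,
              div_eq_mul_inv (θ ^ (2 / α))]
            generalize θ ^ (2 / α) = a at h3 ⊢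
            generalize θ ^ (-2 / α) = b at h3 ⊢
            generalize (t ^ (2 / α))⁻¹ = d
            linear_combination (-(2 / α * Real.pi * lam * d * Real.Gamma (2 / α))) * h3
          calc neighborConst lam α (max θ t) * _
              ≤ neighborConst lam α θ * (θ / t) ^ (2 / α) * _ :=
                mul_le_mul_of_nonneg_right (h1.trans h2.le) hexp
            _ ≤ neighborConst lam α θ * p := by
                rw [mul_assoc]
                exact mul_le_mul_of_nonneg_left hp hc.le

/-- If a single frame succeeds with probability at most `p`, then `n` frames fail with probability
at least `(1 - p) ^ n`. -/
theorem one_sub_pow_le_errorProb {α θ γ δ p : ℝ} (hlam : 0 < lam) (hα : 1 ≤ α) (hθ : 0 < θ)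
    (hγ : 0 < γ) (hδ : 0 < δ) (hp : (θ * γ / δ) ^ (2 / α) *
      ((Real.exp (-neighborConst lam α θ) + neighborConst lam α θ - 1) /
        neighborConst lam α θ ^ 2) ≤ p) (n : ℕ) :
    ENNReal.ofReal (max 0 (1 - p)) ^ n ≤ N.errorProb α θ γ δ n := by
  have hα0 : 0 < α := by linarith
  have hc := neighborConst_pos hα0 hθ hlam
  have hmean := N.meanNeighbors_eq hlam hα hθ
  have hp0 : 0 ≤ min 1 p := by
    refine le_min zero_le_one (le_trans ?_ hp)
    have := Real.add_one_le_exp (-neighborConst lam α θ)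
    exact mul_nonneg (by positivity) (div_nonneg (by linarith) (by positivity))
  have hmax : max 0 (1 - p) = 1 - min 1 p := by
    rcases le_total 1 p with h | h
    · rw [min_eq_left h, max_eq_left (by linarith)]
      ring
    · rw [min_eq_right h, max_eq_right (by linarith)]
  have hp' : (θ / (δ / γ)) ^ (2 / α) *
      ((Real.exp (-neighborConst lam α θ) + neighborConst lam α θ - 1) /
        neighborConst lam α θ ^ 2) ≤ p := by
    rwa [div_div_eq_mul_div]
  let D : ℕ → Set ((ℕ → Plane) × (Sym2 Node → ℝ)) := fun i => {z | θ ≤ linkGain α z none (some i)}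
  have hD : ∀ i, MeasurableSet (D i) := fun i =>
    measurableSet_le measurable_const (measurable_linkGain α none (some i))
  have hDN : ∀ i, N.environment ⁻¹' D i = {ω | N.IsNeighbor α θ ω none (some i)} := by
    intro i
    ext ω
    simp [D, IsNeighbor, gain_eq_linkGain]
  have hDsum : ∑' i, μ (N.environment ⁻¹' D i) = N.meanNeighbors α θ := by
    rw [meanNeighbors_eq_tsum]
    exact tsum_congr fun i => by rw [hDN]
  have hT : ∑' i, μ {ω | N.environment ω ∈ D i ∧ (N.environment ω, fun j => N.timer 0 j ω) ∈
      strongTransmission α θ (δ / γ) i} ≤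
      (∑' i, μ (N.environment ⁻¹' D i)) * ENNReal.ofReal (min 1 p) := by
    have hDN' : ∀ i ω, N.environment ω ∈ D i ↔ N.IsNeighbor α θ ω none (some i) :=
      fun i ω => Set.ext_iff.1 (hDN i) ω
    simp_rw [hDsum, hDN']
    exact N.tsum_measure_isNeighbor_inter_le hlam hα hθ (div_pos hδ hγ) hp'
  have hJ := tsum_mul_one_sub_pow_le N.measurable_environment N.measurable_frame N.iIndepFun_frame
    (fun k => (N.map_frame k).trans (N.map_frame 0).symm) N.indepFun_environment_timer hD
    (measurableSet_strongTransmission α θ (δ / γ))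
    (ENNReal.ofReal_le_one.2 (min_le_left 1 p)) (by rw [hDsum, hmean]; exact ENNReal.ofReal_ne_top)
    hT n
  rw [hDsum] at hJ
  have hmissed : ∑' i, μ {ω | N.environment ω ∈ D i ∧ ∀ k < n,
      (N.environment ω, fun j => N.timer k j ω) ∉ strongTransmission α θ (δ / γ) i} ≤
      N.meanMissed α θ γ δ n := by
    rw [← lintegral_encard_setOf]
    · refine lintegral_mono fun ω => ENat.toENNReal_mono (Set.encard_le_encard fun i hi => ?_)
      exact ⟨(hDN i).subset hi.1, fun k hk hr =>
        hi.2 k hk (Received.mem_strongTransmission N hγ hδ hr)⟩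
    · intro i
      refine (N.measurable_environment (hD i)).inter ?_
      have h := MeasurableSet.iInter fun k : ℕ => (MeasurableSet.const (k < n)).imp
        ((N.measurable_environment.prodMk (N.measurable_frame k))
          (measurableSet_strongTransmission α θ (δ / γ) i)).compl
      rw [← Set.ofPred_forall] at h
      exact h
  have hsub : ENNReal.ofReal (max 0 (1 - p)) = 1 - ENNReal.ofReal (min 1 p) := by
    rw [hmax, ENNReal.ofReal_sub _ hp0, ENNReal.ofReal_one]
  have hpos : N.meanNeighbors α θ ≠ 0 := by
    rw [hmean]
    simpa using hc
  have hfin : N.meanNeighbors α θ ≠ ∞ := by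
    rw [hmean]
    exact ENNReal.ofReal_ne_top
  rw [errorProb, ENNReal.le_div_iff_mul_le (Or.inl hpos) (Or.inl hfin), hsub, mul_comm]
  exact hJ.trans hmissed

end Network

/-- `S` is the number of symbols in a frame, which must be at least `L / log₂ (1 + δ)`, and
`Mc / S` is the number of complete frames within `Mc` symbols. -/
theorem proposition2 {Ω : Type*} [MeasurableSpace Ω] (μ : Measure Ω) [IsProbabilityMeasure μ]
    (lam α θ γ δ : ℝ) (hlam : 0 < lam) (hα : 2 < α) (hθ : 0 < θ) (hγ : 0 < γ) (hδ : 0 < δ)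
    (N : Network μ lam) (L Mc S : ℕ) (hL : 0 < L)
    (hS : (L : ℝ) / Real.logb 2 (1 + δ) ≤ (S : ℝ)) :
    N.meanNeighbors α θ = ENNReal.ofReal (neighborConst lam α θ) ∧
    (max 0 (1 - 1 / neighborConst lam α θ ^ 2 * (θ * γ / δ) ^ (2 / α) *
        (Real.exp (-neighborConst lam α θ) + neighborConst lam α θ - 1))) ^
          ((Mc : ℝ) * Real.logb 2 (1 + δ) / (L : ℝ))
      ≤ (N.errorProb α θ γ δ (Mc / S)).toReal := by
  have hα1 : 1 ≤ α := by linarith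
  refine ⟨N.meanNeighbors_eq hlam hα1 hθ, ?_⟩
  set c := neighborConst lam α θ with hc
  set p := 1 / c ^ 2 * (θ * γ / δ) ^ (2 / α) * (Real.exp (-c) + c - 1) with hp
  have hlog : 0 < Real.logb 2 (1 + δ) := Real.logb_pos one_lt_two (by linarith)
  have hL' : (0 : ℝ) < L := by exact_mod_cast hL
  have hS' : (0 : ℝ) < S := (div_pos hL' hlog).trans_le hS
  have hp0 : 0 ≤ p := by
    have := Real.add_one_le_exp (-c)
    exact mul_nonneg (by positivity) (by linarith)
  have hb0 : 0 ≤ max 0 (1 - p) := le_max_left _ _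
  have hb1 : max 0 (1 - p) ≤ 1 := max_le zero_le_one (by linarith)
  have herr := N.one_sub_pow_le_errorProb hlam hα1 hθ hγ hδ (p := p)
    (le_of_eq (by rw [hp]; ring)) (Mc / S)
  have hfin : N.errorProb α θ γ δ (Mc / S) ≠ ∞ :=
    ne_top_of_le_ne_top ENNReal.one_ne_top
      (ENNReal.div_le_of_le_mul (by rw [one_mul]; exact N.meanMissed_le_meanNeighbors α θ γ δ _))
  have hnum : ((Mc / S : ℕ) : ℝ) ≤ Mc * Real.logb 2 (1 + δ) / L := by
    refine Nat.cast_div_le.trans ?_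
    rw [div_le_div_iff₀ hS' hL']
    rw [div_le_iff₀ hlog] at hS
    calc (Mc : ℝ) * L ≤ Mc * (S * Real.logb 2 (1 + δ)) := by gcongr
      _ = Mc * Real.logb 2 (1 + δ) * S := by ring
  calc max 0 (1 - p) ^ ((Mc : ℝ) * Real.logb 2 (1 + δ) / L)
      ≤ max 0 (1 - p) ^ (Mc / S) := by
        rcases hb0.eq_or_lt with h0 | h0
        · rw [← h0]
          -- At base `0` the conventions `0 ^ 0 = 1` must agree: no symbols means no frames.
          rcases Nat.eq_zero_or_pos Mc with rfl | hM
          · simp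
          · have hM' : (0 : ℝ) < Mc := by exact_mod_cast hM
            rw [Real.zero_rpow (by positivity)]
            positivity
        · rw [← Real.rpow_natCast]
          exact Real.rpow_le_rpow_of_exponent_ge h0 hb1 hnum
    _ ≤ (N.errorProb α θ γ δ (Mc / S)).toReal := by
        rw [← ENNReal.ofReal_le_iff_le_toReal hfin, ENNReal.ofReal_pow hb0]
        exact herr
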